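/- Let $n\ge 1$, $1<p<\infty$, $0<q<p-1$ and $0<\alpha<\frac np$. For a nonnegative locally finite Borel measure $\mu$ on $\mathbb R^n$ put $$\mathbf W_{\alpha,p}\mu(x)=\int_0^\infty\Big[\frac{\mu(B(x,r))}{r^{n-\alpha p}}\Big]^{\frac1{p-1}}\frac{dr}r\in[0,\infty],\qquad x\in\mathbb R^n,$$ where $B(x,r)$ is the open Euclidean ball. Let $\sigma\neq0$ be a nonnegative locally finite Borel measure on $\mathbb R^n$. For a Borel set $E$ let $\kappa(E)\in[0,\infty]$ be the least constant in the inequality $$\Big(\int_E(\mathbf W_{\alpha,p}\nu)^q\,d\sigma\Big)^{\frac1q}\le\kappa(E)\,\nu(\mathbb R^n)^{\frac1{p-1}}\quad\text{for all nonnegative locally finite Borel measures }\nu\text{ on }\mathbb R^n,$$ and put $$\mathbf K_{\alpha,p}\sigma(x)=\int_0^\infty\Big[\frac{\kappa(B(x,s))^{\frac{q(p-1)}{p-1-q}}}{s^{n-\alpha p}}\Big]^{\frac1{p-1}}\frac{ds}s .$$ Functions $u$ below take values in $[0,\infty]$, and $u\in L^q_{\rm loc}(\mathbb R^n,d\sigma)$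 means that $u$ is $\sigma$-measurable with $\int_B u^q\,d\sigma<\infty$ for every ball $B$. There is a constant $C>0$ depending only on $n,p,q,\alpha$ such that the following holds for every such $\sigma$. (i) Suppose that $$\int_1^\infty\Big[\frac{\sigma(B(0,r))}{r^{n-\alpha p}}\Big]^{\frac1{p-1}}\frac{dr}r<\infty\quad\text{and}\quad\int_1^\infty\Big[\frac{\kappa(B(0,s))^{\frac{q(p-1)}{p-1-q}}}{s^{n-\alpha p}}\Big]^{\frac1{p-1}}\frac{ds}s<\infty .$$ Then there is $u\in L^q_{\rm loc}(\mathbb R^n,d\sigma)$ with $u>0$ and $u=\mathbf W_{\alpha,p}(u^q\,d\sigma)$ everywhere in $\mathbb R^n$, with $\liminf_{|x|\to\infty}u(x)=0$, and with $$C^{-1}\Big[\mathbf K_{\alpha,p}\sigma+(\mathbf W_{\alpha,p}\sigma)^{\frac{p-1}{p-1-q}}\Big]\le u\le C\Big[\mathbf K_{\alpha,p}\sigma+(\mathbf W_{\alpha,p}\sigma)^{\frac{p-1}{p-1-q}}\Big]\quad\text{everywhere in }\mathbb R^n .$$ (ii) Let $u\in L^q_{\rm loc}(\mathbb R^n,d\sigma)$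 satisfy $u\ge\mathbf W_{\alpha,p}(u^q\,d\sigma)$ $\sigma$-a.e., and suppose that $u$ is nontrivial, that is, not equal to $0$ $\sigma$-a.e. Then the lower bound $$u\ge C^{-1}\Big[\mathbf K_{\alpha,p}\sigma+(\mathbf W_{\alpha,p}\sigma)^{\frac{p-1}{p-1-q}}\Big]$$ holds $\sigma$-a.e., and at every point where $u\ge\mathbf W_{\alpha,p}(u^q\,d\sigma)$ holds. -/

import Mathlib

open MeasureTheory Set Filter
open scoped ENNReal

noncomputable section

/-- `∫_t^∞ [m(r) / r^(n - αp)]^(1/(p-1)) dr/r`, as an integral with values in `[0, ∞]`. -/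
def wolffTail (n : ℕ) (α p : ℝ) (m : ℝ → ℝ≥0∞) (t : ℝ) : ℝ≥0∞ :=
  ∫⁻ r in Ioi t, (m r / ENNReal.ofReal (r ^ ((n : ℝ) - α * p))) ^ (1 / (p - 1)) /
    ENNReal.ofReal r

/-- The Wolff potential
`W_{α,p} σ (x) = ∫_0^∞ [σ(B(x,r)) / r^(n - αp)]^(1/(p-1)) dr/r`. -/
def wolffPotential (n : ℕ) (α p : ℝ) (σ : Measure (EuclideanSpace ℝ (Fin n)))
    (x : EuclideanSpace ℝ (Fin n)) : ℝ≥0∞ :=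
  wolffTail n α p (fun r => σ (Metric.ball x r)) 0

/-- The least constant `κ(E) ∈ [0, ∞]` in the localized weighted norm inequality
`‖W_{α,p} ν‖_{L^q(E, dσ)} ≤ κ(E) ν(ℝⁿ)^(1/(p-1))`, for all locally finite Borel
measures `ν ≥ 0` on `ℝⁿ`. It is `∞` if no finite constant works. -/
def kappa (n : ℕ) (α p q : ℝ) (σ : Measure (EuclideanSpace ℝ (Fin n)))
    (E : Set (EuclideanSpace ℝ (Fin n))) : ℝ≥0∞ :=
  sInf {k : ℝ≥0∞ | ∀ ν : Measure (EuclideanSpace ℝ (Fin n)), IsLocallyFiniteMeasure ν →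
    (∫⁻ y in E, wolffPotential n α p ν y ^ q ∂σ) ^ (1 / q) ≤ k * ν univ ^ (1 / (p - 1))}

/-- The function `s ↦ κ(B(x,s))^(q(p-1)/(p-1-q))`. -/
def kappaPow (n : ℕ) (α p q : ℝ) (σ : Measure (EuclideanSpace ℝ (Fin n)))
    (x : EuclideanSpace ℝ (Fin n)) (s : ℝ) : ℝ≥0∞ :=
  kappa n α p q σ (Metric.ball x s) ^ (q * (p - 1) / (p - 1 - q))

/-- The intrinsic potential of Wolff type
`K_{α,p} σ (x) = ∫_0^∞ [κ(B(x,s))^(q(p-1)/(p-1-q)) / s^(n - αp)]^(1/(p-1)) ds/s`. -/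
def intrinsicPotential (n : ℕ) (α p q : ℝ) (σ : Measure (EuclideanSpace ℝ (Fin n)))
    (x : EuclideanSpace ℝ (Fin n)) : ℝ≥0∞ :=
  wolffTail n α p (kappaPow n α p q σ x) 0

/-- `u : ℝⁿ → [0, ∞]` belongs to `L^q_loc(ℝⁿ, dσ)`: it is `σ`-measurable and `u ^ q` has
finite integral over every ball. -/
def MemLqLoc (n : ℕ) (q : ℝ) (σ : Measure (EuclideanSpace ℝ (Fin n)))
    (u : EuclideanSpace ℝ (Fin n) → ℝ≥0∞) : Prop :=
  AEMeasurable u σ ∧ ∀ (x : EuclideanSpace ℝ (Fin n)) (r : ℝ),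
    ∫⁻ y in Metric.ball x r, u y ^ q ∂σ < ∞

/-- `W_{α,p} (u^q dσ)`. -/
def wolffOp (n : ℕ) (α p q : ℝ) (σ : Measure (EuclideanSpace ℝ (Fin n)))
    (u : EuclideanSpace ℝ (Fin n) → ℝ≥0∞) : EuclideanSpace ℝ (Fin n) → ℝ≥0∞ :=
  wolffPotential n α p (σ.withDensity fun y => u y ^ q)

/-- A solution `u ∈ L^q_loc(dσ)` of `u = W_{α,p} (u^q dσ)`, `u > 0`, everywhere in `ℝⁿ`. -/
structure IsWolffSolution (n : ℕ) (α p q : ℝ) (σ : Measure (EuclideanSpace ℝ (Fin n)))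
    (u : EuclideanSpace ℝ (Fin n) → ℝ≥0∞) : Prop where
  memLqLoc : MemLqLoc n q σ u
  pos : ∀ x, 0 < u x
  eq : ∀ x, u x = wolffOp n α p q σ u x

/-- A nontrivial supersolution `u ∈ L^q_loc(dσ)`: `u ≥ W_{α,p} (u^q dσ)` `σ`-almost
everywhere, and `u` is not `σ`-almost everywhere zero. -/
structure IsNontrivialWolffSupersolution (n : ℕ) (α p q : ℝ)
    (σ : Measure (EuclideanSpace ℝ (Fin n)))
    (u : EuclideanSpace ℝ (Fin n) → ℝ≥0∞) : Prop where
  memLqLoc : MemLqLoc n q σ u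
  le : ∀ᵐ x ∂σ, wolffOp n α p q σ u x ≤ u x
  nontrivial : ¬ ∀ᵐ x ∂σ, u x = 0

/-- `K_{α,p} σ + (W_{α,p} σ)^((p-1)/(p-1-q))`. -/
def wolffBound (n : ℕ) (α p q : ℝ) (σ : Measure (EuclideanSpace ℝ (Fin n)))
    (x : EuclideanSpace ℝ (Fin n)) : ℝ≥0∞ :=
  intrinsicPotential n α p q σ x + wolffPotential n α p σ x ^ ((p - 1) / (p - 1 - q))

end

/-! ### Calculus of truncated Wolff integrals. -/

section Tail

variable {n : ℕ} {α p : ℝ} {m m' : ℝ → ℝ≥0∞} {s t : ℝ}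

/-! Write δ = (p-1)/(p-1-q), and W, K for the two potentials. The operator u ↦ W(u^q dσ) is monotone
and homogeneous of degree q/(p-1) < 1, so any loss by a constant in an iteration can be absorbed at
the end.

Lower bound by K. Let ω = u^q dσ for a supersolution u. A Vitali covering bounds the ω-measure of
{cWω < Wν} by a multiple of c^{-(p-1)} ν(ℝⁿ). Since (Wω)^q dσ ≤ dω, summing over dyadic c gives ∫_E
(Wν)^q dσ ≤ C ω(E)^{1-q/(p-1)} ν(ℝⁿ)^{q/(p-1)}, because q < p-1. Hence κ(E)^{q(p-1)/(p-1-q)} ≤ C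
ω(E) (`kappa_rpow_le`); inserting balls yields K ≤ C Wω.

Lower bound by (Wσ)^δ. The truncations V = min(Wσ, M)^δ satisfy V ≤ L W(V^q dσ). Comparing Wω with
multiples of V on a ball, the best multiple c satisfies c ≥ c^{q/(p-1)}/L, so c ≥ L^{-δ}.

Existence and upper bound. Iterating from a small bounded subsolution gives a monotone limit
`wolffSol` solving the equation in [0, ∞], perhaps with infinite values. For σ restricted to a ball
B, its energy is at most κ(B)^{q(p-1)/(p-1-q)}, so if κ(B) is finite both lower bounds apply to this
local solution. Let h = K + (Wσ)^δ. Up to constants, h on the concentric ball of half the radius is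
at most the local solution plus tails of the potentials at the centre (`wolffBound_le_of_mem_ball`).
Integration gives W(h^q dσ) ≤ C h, so C^δ h is a supersolution dominating every iterate. The tail
conditions at 0 then give local integrability of the limit.

Decay. The covering lemma with Lebesgue measure finds points far away around which ω has controlled
density at small scales; there Wω is bounded by a tail at the origin, which tends to 0. -/

theorem ENNReal.add_rpow_le_two_rpow_mul {a : ℝ} (ha : 0 ≤ a) (x y : ℝ≥0∞) :
    (x + y) ^ a ≤ 2 ^ a * (x ^ a + y ^ a) := by
  have h : x + y ≤ 2 * max x y := by
    rw [two_mul]; exact add_le_add (le_max_left _ _) (le_max_right _ _)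
  calc (x + y) ^ a ≤ (2 * max x y) ^ a := ENNReal.rpow_le_rpow h ha
    _ = 2 ^ a * (max x y) ^ a := ENNReal.mul_rpow_of_nonneg _ _ ha
    _ ≤ 2 ^ a * (x ^ a + y ^ a) := by
      gcongr
      rcases le_total x y with h | h
      · rw [max_eq_right h]; exact le_add_self
      · rw [max_eq_left h]; exact le_self_add

theorem one_div_sub_one_pos (hp : 1 < p) : 0 < 1 / (p - 1) := one_div_pos.2 (sub_pos.2 hp)

theorem wolffTail_mono (hp : 1 < p) (h : ∀ r, t < r → m r ≤ m' r) :
    wolffTail n α p m t ≤ wolffTail n α p m' t := by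
  have ha := (one_div_sub_one_pos hp).le
  refine setLIntegral_mono' measurableSet_Ioi fun r hr => ?_
  gcongr
  exact h r hr

theorem wolffTail_anti (h : s ≤ t) : wolffTail n α p m t ≤ wolffTail n α p m s :=
  lintegral_mono_set (Ioi_subset_Ioi h)

theorem measurable_wolffTail_integrand (hm : Measurable m) :
    Measurable fun r : ℝ => (m r / ENNReal.ofReal (r ^ ((n : ℝ) - α * p))) ^ (1 / (p - 1)) /
      ENNReal.ofReal r := by
  fun_prop

theorem wolffTail_const_mul (hp : 1 < p) {c : ℝ≥0∞} (hc : c ≠ ∞) :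
    wolffTail n α p (fun r => c * m r) t = c ^ (1 / (p - 1)) * wolffTail n α p m t := by
  have ha := (one_div_sub_one_pos hp).le
  rw [wolffTail, wolffTail, ← lintegral_const_mul' _ _ (ENNReal.rpow_ne_top_of_nonneg ha hc)]
  refine lintegral_congr fun r => ?_
  rw [mul_div_assoc, ENNReal.mul_rpow_of_nonneg _ _ ha, mul_div_assoc]

theorem wolffTail_add_le (hp : 1 < p) (hm : Measurable m) :
    wolffTail n α p (fun r => m r + m' r) t ≤
      2 ^ (1 / (p - 1)) * (wolffTail n α p m t + wolffTail n α p m' t) := by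
  have ha := (one_div_sub_one_pos hp).le
  rw [wolffTail, wolffTail, wolffTail, ← lintegral_add_left (measurable_wolffTail_integrand hm),
    ← lintegral_const_mul' _ _ (ENNReal.rpow_ne_top_of_nonneg ha (by simp))]
  refine lintegral_mono fun r => ?_
  simpa only [ENNReal.add_div, mul_div_assoc] using ENNReal.div_le_div_right
    (ENNReal.add_rpow_le_two_rpow_mul ha (m r / ENNReal.ofReal (r ^ ((n : ℝ) - α * p)))
      (m' r / ENNReal.ofReal (r ^ ((n : ℝ) - α * p)))) (ENNReal.ofReal r)

/-- Change of variables r ↦ br. Inclusions B(x,r) ⊂ B(y,br) thereby compare potentials at different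
centres at the cost of a constant. -/
theorem wolffTail_comp_mul (hp : 1 < p) {b : ℝ} (hb : 0 < b) (ht : 0 ≤ t) :
    wolffTail n α p (fun r => m (b * r)) t =
      ENNReal.ofReal (b ^ ((n : ℝ) - α * p)) ^ (1 / (p - 1)) * wolffTail n α p m (b * t) := by
  have ha := (one_div_sub_one_pos hp).le
  have himg : (fun r => b * r) '' Ioi t = Ioi (b * t) := by
    rw [Set.image_mul_left_Ioi hb]
  rw [wolffTail, wolffTail, ← himg, lintegral_image_eq_lintegral_deriv_mul_of_monotoneOn
    measurableSet_Ioi (f' := fun _ => b)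
    (fun x _ => by simpa using ((hasDerivAt_id x).const_mul b).hasDerivWithinAt)
    (fun x _ y _ h => mul_le_mul_of_nonneg_left h hb.le),
    ← lintegral_const_mul' _ _ (ENNReal.rpow_ne_top_of_nonneg ha (by simp))]
  refine setLIntegral_congr_fun measurableSet_Ioi fun r hr => ?_
  have hr : 0 < r := ht.trans_lt hr
  have hbγ : 0 < b ^ ((n : ℝ) - α * p) := Real.rpow_pos_of_pos hb _
  have hb0 : ENNReal.ofReal b ≠ 0 := by simpa using hb
  rw [Real.mul_rpow hb.le hr.le, ENNReal.ofReal_mul hbγ.le, ENNReal.ofReal_mul hb.le]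
  have e1 : ∀ x c y : ℝ≥0∞, c ≠ 0 → c ≠ ∞ → x / y = c * (x / (c * y)) := by
    intro x c y h0 h1
    rw [← mul_div_assoc, ENNReal.mul_div_mul_left _ _ h0 h1]
  rw [e1 (m (b * r)) (ENNReal.ofReal (b ^ ((n : ℝ) - α * p))) _ (by simpa using hbγ) (by simp),
    ENNReal.mul_rpow_of_nonneg _ _ ha, mul_div_assoc]
  congr 1
  exact e1 _ _ _ hb0 (by simp)

/-- Only the radii in (t, 2t] are kept; the 1/2 is the length t over the bound 2t for r. -/
theorem le_wolffTail (hp : 1 < p) (hγ : α * p ≤ n) (hm : Monotone m) (ht : 0 < t) :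
    (m t / ENNReal.ofReal ((2 * t) ^ ((n : ℝ) - α * p))) ^ (1 / (p - 1)) / 2 ≤
      wolffTail n α p m t := by
  have ha := (one_div_sub_one_pos hp).le
  have h0 : ENNReal.ofReal t ≠ 0 := by simpa using ht
  calc _ = ∫⁻ r in Ioc t (2 * t),
        (m t / ENNReal.ofReal ((2 * t) ^ ((n : ℝ) - α * p))) ^ (1 / (p - 1)) /
          ENNReal.ofReal (2 * t) := by
        rw [setLIntegral_const, Real.volume_Ioc, show 2 * t - t = t by ring,
          ENNReal.ofReal_mul (by norm_num), div_eq_mul_inv, div_eq_mul_inv _ (_ * _),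
          ENNReal.mul_inv (by simp) (by simp), mul_assoc, mul_assoc,
          ENNReal.inv_mul_cancel h0 (by simp)]
        simp
    _ ≤ ∫⁻ r in Ioc t (2 * t), (m r / ENNReal.ofReal (r ^ ((n : ℝ) - α * p))) ^ (1 / (p - 1)) /
          ENNReal.ofReal r := by
        refine setLIntegral_mono' measurableSet_Ioc fun r hr => ?_
        have hr0 : 0 ≤ r := ht.le.trans hr.1.le
        have h1 := hm hr.1.le
        have h2 := Real.rpow_le_rpow hr0 hr.2 (sub_nonneg.2 hγ)
        have h3 := hr.2
        gcongr
    _ ≤ _ := lintegral_mono_set Ioc_subset_Ioi_self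

theorem wolffTail_iSup (hp : 1 < p) {m : ℕ → ℝ → ℝ≥0∞} (hm : ∀ k, Measurable (m k))
    (hmono : Monotone m) :
    wolffTail n α p (fun r => ⨆ k, m k r) t = ⨆ k, wolffTail n α p (m k) t := by
  have ha := one_div_sub_one_pos hp
  simp only [wolffTail]
  rw [← lintegral_iSup (fun k => measurable_wolffTail_integrand (hm k))]
  · refine lintegral_congr fun r => ?_
    have := (ENNReal.orderIsoRpow (1 / (p - 1)) ha).map_iSup
      fun k => m k r / ENNReal.ofReal (r ^ ((n : ℝ) - α * p))
    simp only [ENNReal.orderIsoRpow_apply] at this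
    rw [ENNReal.iSup_div, this, ENNReal.iSup_div]
  · intro i j hij r
    simp only
    have := ha.le
    gcongr
    exact hmono hij r

theorem monotone_measure_ball {X : Type*} [PseudoMetricSpace X] [MeasurableSpace X]
    (μ : Measure X) (x : X) : Monotone fun r => μ (Metric.ball x r) :=
  fun _ _ h => measure_mono (Metric.ball_subset_ball h)

theorem exists_measure_ball_pos {X : Type*} [PseudoMetricSpace X] [MeasurableSpace X]
    {μ : Measure X} (hμ : μ ≠ 0) (x : X) : ∃ k : ℕ, 0 < μ (Metric.ball x k) := by
  by_contra! h
  apply hμ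
  rw [← Measure.measure_univ_eq_zero, ← Metric.iUnion_ball_nat x]
  exact measure_iUnion_null fun k => le_antisymm (h k) bot_le

end Tail

/-! ### Monotonicity, measurability and positivity of Wolff potentials. -/

section Potential

variable {n : ℕ} {α p : ℝ} {μ ν : Measure (EuclideanSpace ℝ (Fin n))}

theorem wolffPotential_mono (hp : 1 < p) (h : ∀ x r, μ (Metric.ball x r) ≤ ν (Metric.ball x r)) (x) :
    wolffPotential n α p μ x ≤ wolffPotential n α p ν x :=
  wolffTail_mono hp fun r _ => h x r

theorem measurable_wolffPotential [SFinite μ] : Measurable (wolffPotential n α p μ) := by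
  have h : Measurable fun z : EuclideanSpace ℝ (Fin n) × ℝ => μ (Metric.ball z.1 z.2) := by
    have hs : MeasurableSet {w : (EuclideanSpace ℝ (Fin n) × ℝ) × EuclideanSpace ℝ (Fin n) |
        dist w.2 w.1.1 < w.1.2} :=
      (isOpen_lt (by fun_prop) (by fun_prop)).measurableSet
    exact measurable_measure_prodMk_left (ν := μ) hs
  have h2 : Measurable fun z : EuclideanSpace ℝ (Fin n) × ℝ =>
      (μ (Metric.ball z.1 z.2) / ENNReal.ofReal (z.2 ^ ((n : ℝ) - α * p))) ^ (1 / (p - 1)) /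
        ENNReal.ofReal z.2 :=
    ((h.div (by fun_prop)).pow_const _).div (by fun_prop)
  exact h2.lintegral_prod_right'

theorem wolffPotential_pos (hp : 1 < p) (hγ : α * p ≤ n) (hμ : μ ≠ 0) (x) :
    0 < wolffPotential n α p μ x := by
  have ha := one_div_sub_one_pos hp
  obtain ⟨k, hk⟩ := exists_measure_ball_pos hμ x
  have hk0 : 0 < (k : ℝ) := by
    by_contra! h
    simp [Metric.ball_eq_empty.2 h] at hk
  refine lt_of_lt_of_le ?_ ((le_wolffTail hp hγ (monotone_measure_ball μ x) hk0).trans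
    (wolffTail_anti hk0.le))
  exact ENNReal.div_pos (ENNReal.rpow_pos_of_nonneg (ENNReal.div_pos hk.ne' (by simp)) ha.le).ne'
    (by simp)

theorem wolffPotential_zero (hp : 1 < p) (x) :
    wolffPotential n α p (0 : Measure (EuclideanSpace ℝ (Fin n))) x = 0 := by
  have ha := one_div_sub_one_pos hp
  simp [wolffPotential, wolffTail, ENNReal.zero_rpow_of_pos ha, -one_div]

end Potential

/-! ### Weak-type comparison of potentials and the lower bound by the intrinsic potential. -/

section WeakType

/-- Vitali covering: a weak type estimate for the maximal ratio of two measures over balls. -/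
theorem mul_measure_ratio_le {X : Type*} [PseudoMetricSpace X] [SecondCountableTopology X]
    [MeasurableSpace X] [OpensMeasurableSpace X] (μ ν : Measure X) (t : ℝ≥0∞) :
    t * μ {x | ∃ r : ℝ, 0 < r ∧ t * μ (Metric.ball x (6 * r)) < ν (Metric.ball x r)} ≤ ν univ := by
  -- The covering lemma needs bounded radii, so radii are capped by k and the caps removed by
  -- monotone union.
  set A : ℕ → Set X := fun k =>
    {x | ∃ r : ℝ, 0 < r ∧ r ≤ k ∧ t * μ (Metric.ball x (6 * r)) < ν (Metric.ball x r)} with hA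
  have hU : {x | ∃ r : ℝ, 0 < r ∧ t * μ (Metric.ball x (6 * r)) < ν (Metric.ball x r)} =
      ⋃ k, A k := by
    ext x
    simp only [hA, mem_ofPred_eq, mem_iUnion]
    constructor
    · rintro ⟨r, h0, h1⟩
      obtain ⟨k, hk⟩ := exists_nat_ge r
      exact ⟨k, r, h0, hk, h1⟩
    · rintro ⟨k, r, h0, -, h1⟩
      exact ⟨r, h0, h1⟩
  have hmono : Monotone A := by
    rintro i j hij x ⟨r, h0, h1, h2⟩
    exact ⟨r, h0, h1.trans (by exact_mod_cast hij), h2⟩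
  rw [hU, hmono.directed_le.measure_iUnion, ENNReal.mul_iSup]
  refine iSup_le fun k => ?_
  set T : Set (X × ℝ) := {z | 0 < z.2 ∧ z.2 ≤ k ∧
    t * μ (Metric.ball z.1 (6 * z.2)) < ν (Metric.ball z.1 z.2)} with hT
  -- Vitali enlarges closed balls by 5; the factor 6 leaves room to pass to open balls.
  obtain ⟨u, huT, hdisj, hcov⟩ := Vitali.exists_disjoint_subfamily_covering_enlargement_closedBall
    T (fun z => z.1) (fun z => z.2) k (fun z hz => hz.2.1) 5 (by norm_num)
  have hdisj' : u.PairwiseDisjoint fun z => Metric.ball z.1 z.2 :=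
    hdisj.mono fun z => Metric.ball_subset_closedBall
  have hcount : u.Countable := hdisj'.countable_of_isOpen (fun _ _ => Metric.isOpen_ball)
    fun z hz => Metric.nonempty_ball.2 (huT hz).1
  have hsub : A k ⊆ ⋃ z ∈ u, Metric.ball z.1 (6 * z.2) := by
    rintro x ⟨r, h0, h1, h2⟩
    obtain ⟨b, hb, hxb⟩ := hcov (x, r) ⟨h0, h1, h2⟩
    have hbpos := (huT hb).1
    exact mem_biUnion hb (Metric.closedBall_subset_ball (by linarith)
      (hxb (Metric.mem_closedBall_self h0.le)))
  have := hcount.to_subtype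
  calc t * μ (A k) ≤ t * ∑' z : u, μ (Metric.ball z.1.1 (6 * z.1.2)) := by
        gcongr
        exact (measure_mono hsub).trans (measure_biUnion_le μ hcount _)
    _ = ∑' z : u, t * μ (Metric.ball z.1.1 (6 * z.1.2)) := ENNReal.tsum_mul_left.symm
    _ ≤ ∑' z : u, ν (Metric.ball z.1.1 z.1.2) :=
        ENNReal.tsum_le_tsum fun z => (huT z.2).2.2.le
    _ = ν (⋃ z ∈ u, Metric.ball z.1 z.2) :=
        (measure_biUnion hcount hdisj' fun _ _ => Metric.isOpen_ball.measurableSet).symm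
    _ ≤ ν univ := measure_mono (subset_univ _)

variable {n : ℕ} {α p q : ℝ}

theorem wolffPotential_le_of_ratio (hp : 1 < p) {μ ν : Measure (EuclideanSpace ℝ (Fin n))}
    {x : EuclideanSpace ℝ (Fin n)} {c : ℝ≥0∞} (hc : c ≠ ∞)
    (h : ∀ r : ℝ, 0 < r → ν (Metric.ball x r) ≤ c * μ (Metric.ball x (6 * r))) :
    wolffPotential n α p ν x ≤ c ^ (1 / (p - 1)) *
      (ENNReal.ofReal (6 ^ ((n : ℝ) - α * p)) ^ (1 / (p - 1)) * wolffPotential n α p μ x) := by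
  have := wolffTail_comp_mul (n := n) (α := α) (t := 0) hp (m := fun r => μ (Metric.ball x r))
    (b := 6) (by norm_num) le_rfl
  rw [mul_zero] at this
  rw [wolffPotential, wolffPotential, ← this, ← wolffTail_const_mul hp hc]
  exact wolffTail_mono hp h

/-- If Wν exceeds c Wμ at x, then the ratio ν(B(x,r))/μ(B(x,6r)) must be large at some radius, by
the contrapositive of `wolffPotential_le_of_ratio`. The covering estimate bounds the set of such x.
-/
theorem rpow_mul_measure_wolffPotential_lt_le (hp : 1 < p)
    (μ ν : Measure (EuclideanSpace ℝ (Fin n))) {c : ℝ≥0∞} (hc : c ≠ ∞) :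
    c ^ (p - 1) * μ {x | c * wolffPotential n α p μ x < wolffPotential n α p ν x} ≤
      ENNReal.ofReal (6 ^ ((n : ℝ) - α * p)) * ν univ := by
  set B := ENNReal.ofReal ((6 : ℝ) ^ ((n : ℝ) - α * p)) with hB
  have hB0 : B ≠ 0 := by
    have : (0 : ℝ) < 6 ^ ((n : ℝ) - α * p) := by positivity
    simpa [hB] using this
  have hBt : B ≠ ∞ := by simp [hB]
  have hp1 : 0 < p - 1 := sub_pos.2 hp
  have ha := one_div_sub_one_pos hp
  have hl : c ^ (p - 1) / B ≠ ∞ :=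
    ENNReal.div_ne_top (ENNReal.rpow_ne_top_of_nonneg hp1.le hc) hB0
  have key : (c ^ (p - 1) / B) ^ (1 / (p - 1)) * B ^ (1 / (p - 1)) = c := by
    rw [← ENNReal.mul_rpow_of_nonneg _ _ ha.le, ENNReal.div_mul_cancel hB0 hBt, ← ENNReal.rpow_mul,
      mul_one_div_cancel hp1.ne', ENNReal.rpow_one]
  have hsub : {x | c * wolffPotential n α p μ x < wolffPotential n α p ν x} ⊆
      {x | ∃ r : ℝ, 0 < r ∧
        c ^ (p - 1) / B * μ (Metric.ball x (6 * r)) < ν (Metric.ball x r)} := by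
    intro x hx
    by_contra hcon
    simp only [mem_ofPred_eq, not_exists, not_and, not_lt] at hcon
    have := wolffPotential_le_of_ratio (n := n) (α := α) hp hl hcon
    rw [← mul_assoc, key] at this
    exact absurd hx (not_lt.2 this)
  calc c ^ (p - 1) * μ {x | c * wolffPotential n α p μ x < wolffPotential n α p ν x}
      = B * (c ^ (p - 1) / B *
          μ {x | c * wolffPotential n α p μ x < wolffPotential n α p ν x}) := by
        rw [← mul_assoc, ENNReal.mul_div_cancel hB0 hBt]
    _ ≤ B * ν univ := by
        gcongr
        exact le_trans (by gcongr) (mul_measure_ratio_le μ ν (c ^ (p - 1) / B))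

/-- Take the least k with v ≤ 2^k τ w: for k = 0 the first summand suffices, otherwise the term of
index k-1 does. If no such k exists, every term is at least (τw)^q and the sum is infinite. -/
theorem rpow_le_dyadic_sum (hq : 0 < q) {v w τ : ℝ≥0∞} (hw : w ≠ 0) (hτ : τ ≠ 0) :
    v ^ q ≤ τ ^ q * w ^ q + ∑' k : ℕ, if 2 ^ k * τ * w < v then (2 ^ (k + 1) * τ) ^ q * w ^ q
      else 0 := by
  have hz : τ * w ≠ 0 := mul_ne_zero hτ hw
  by_cases hall : ∀ k : ℕ, 2 ^ k * τ * w < v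
  · have : ∑' k : ℕ, (if 2 ^ k * τ * w < v then (2 ^ (k + 1) * τ) ^ q * w ^ q else 0) = ∞ := by
      rw [eq_top_iff, ← ENNReal.tsum_const_eq_top_of_ne_zero (α := ℕ) (c := (τ * w) ^ q)
        (ENNReal.rpow_pos_of_nonneg hz.bot_lt hq.le).ne']
      refine ENNReal.tsum_le_tsum fun k => ?_
      rw [if_pos (hall k), ← ENNReal.mul_rpow_of_nonneg _ _ hq.le, mul_assoc]
      have h1 : (1 : ℝ≥0∞) ≤ 2 ^ (k + 1) := one_le_pow₀ (by norm_num)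
      exact ENNReal.rpow_le_rpow ((one_mul (τ * w)).symm.le.trans (mul_le_mul_left h1 _)) hq.le
    rw [this]; simp
  · push Not at hall
    classical
    set k := Nat.find hall with hk
    have hk1 : v ≤ 2 ^ k * τ * w := Nat.find_spec hall
    rcases Nat.eq_zero_or_pos k with h0 | h0
    · rw [h0, pow_zero, one_mul] at hk1
      refine le_add_right ?_
      rw [← ENNReal.mul_rpow_of_nonneg _ _ hq.le]
      exact ENNReal.rpow_le_rpow hk1 hq.le
    · obtain ⟨j, hj⟩ : ∃ j, k = j + 1 := ⟨k - 1, by omega⟩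
      have hj1 : 2 ^ j * τ * w < v := not_le.1 (Nat.find_min hall (m := j) (by omega))
      refine le_add_left (le_trans ?_ (ENNReal.le_tsum j))
      rw [if_pos hj1, ← ENNReal.mul_rpow_of_nonneg _ _ hq.le, ← hj]
      exact ENNReal.rpow_le_rpow hk1 hq.le

/-- The constant in `lintegral_wolffPotential_rpow_le`. -/
noncomputable def energyConst (n : ℕ) (α p q : ℝ) : ℝ≥0∞ :=
  1 + 2 ^ q * ENNReal.ofReal (6 ^ ((n : ℝ) - α * p)) * (1 - 2 ^ (q - (p - 1)))⁻¹

theorem energyConst_ne_top (hq : 0 < q) (hqp : q < p - 1) : energyConst n α p q ≠ ∞ := by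
  have : (2 : ℝ≥0∞) ^ (q - (p - 1)) < 1 := by
    apply ENNReal.rpow_lt_one_of_one_lt_of_neg (by norm_num) (by linarith)
  refine ENNReal.add_ne_top.2 ⟨by simp, ENNReal.mul_ne_top (ENNReal.mul_ne_top
    (ENNReal.rpow_ne_top_of_nonneg hq.le (by simp)) (by simp)) ?_⟩
  exact ENNReal.inv_ne_top.2 (tsub_pos_of_lt this).ne'

theorem one_le_energyConst : 1 ≤ energyConst n α p q := le_self_add

/-- Dyadic decomposition of Wν/Wω with ω = u^q dσ. The supersolution inequality turns (Wω)^q dσ into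
ω, the weak-type bound handles each level set, and the resulting series is geometric with ratio
2^{q-(p-1)} < 1. -/
theorem lintegral_wolffPotential_rpow_le (hp : 1 < p) (hγ : α * p ≤ n) (hq : 0 < q)
    {σ ν : Measure (EuclideanSpace ℝ (Fin n))} [SFinite σ] [SFinite ν]
    {u : EuclideanSpace ℝ (Fin n) → ℝ≥0∞} (hu : ∀ᵐ x ∂σ, wolffOp n α p q σ u x ≤ u x)
    {E : Set (EuclideanSpace ℝ (Fin n))} (hE : MeasurableSet E)
    (hE0 : ∫⁻ y in E, u y ^ q ∂σ ≠ 0) (hEt : ∫⁻ y in E, u y ^ q ∂σ ≠ ∞)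
    (hν0 : ν univ ≠ 0) (hνt : ν univ ≠ ∞) :
    ∫⁻ y in E, wolffPotential n α p ν y ^ q ∂σ ≤
      energyConst n α p q *
        ((∫⁻ y in E, u y ^ q ∂σ) ^ (1 - q / (p - 1)) * ν univ ^ (q / (p - 1))) := by
  set ω := σ.withDensity fun y => u y ^ q with hω
  set J := ∫⁻ y in E, u y ^ q ∂σ with hJ
  set N := ν univ with hN
  set B := ENNReal.ofReal ((6 : ℝ) ^ ((n : ℝ) - α * p)) with hB
  have hp1 : 0 < p - 1 := sub_pos.2 hp
  have hωE : ω E = J := withDensity_apply _ hE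
  have hω0 : ω ≠ 0 := by
    rintro h
    rw [h] at hωE
    exact hE0 (by simpa using hωE.symm)
  have hNJ0 : N / J ≠ 0 := (ENNReal.div_pos hν0 hEt).ne'
  have hNJt : N / J ≠ ∞ := ENNReal.div_ne_top hνt hE0
  -- This threshold makes τ^{p-1} J = N, so the low part and the level sets contribute terms of the
  -- same size.
  set τ := (N / J) ^ (1 / (p - 1)) with hτ
  have hτ0 : τ ≠ 0 := (ENNReal.rpow_pos hNJ0.bot_lt hNJt).ne'
  have hτt : τ ≠ ∞ := ENNReal.rpow_ne_top_of_nonneg (one_div_sub_one_pos hp).le hNJt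
  have hτp : τ ^ (p - 1) = N / J := by
    rw [hτ, ← ENNReal.rpow_mul, one_div_mul_cancel hp1.ne', ENNReal.rpow_one]
  have hWω : Measurable (wolffPotential n α p ω) := measurable_wolffPotential
  have hWν : Measurable (wolffPotential n α p ν) := measurable_wolffPotential
  set A : ℕ → Set (EuclideanSpace ℝ (Fin n)) := fun k =>
    {x | 2 ^ k * τ * wolffPotential n α p ω x < wolffPotential n α p ν x} with hA
  have hAm : ∀ k, MeasurableSet (A k) := fun k =>
    measurableSet_lt (hWω.const_mul _) hWν
  have hint : ∀ S, MeasurableSet S →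
      ∫⁻ y in S, wolffPotential n α p ω y ^ q ∂σ ≤ ω S := by
    intro S hS
    rw [hω, withDensity_apply _ hS]
    refine lintegral_mono_ae (ae_restrict_of_ae ?_)
    filter_upwards [hu] with x hx
    exact ENNReal.rpow_le_rpow hx hq.le
  have hck : ∀ k : ℕ, (2 : ℝ≥0∞) ^ k * τ ≠ ∞ := fun k =>
    ENNReal.mul_ne_top (by simp) hτt
  have hck0 : ∀ k : ℕ, (2 : ℝ≥0∞) ^ k * τ ≠ 0 := fun k => mul_ne_zero (by simp) hτ0
  have hterm : ∀ k, (2 ^ (k + 1) * τ) ^ q * ω (E ∩ A k) ≤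
      2 ^ q * B * (τ ^ q * J) * (2 ^ (q - (p - 1))) ^ k := by
    intro k
    have hcp0 : (2 ^ k * τ) ^ (p - 1) ≠ 0 := (ENNReal.rpow_pos (hck0 k).bot_lt (hck k)).ne'
    have hcpt : (2 ^ k * τ) ^ (p - 1) ≠ ∞ := ENNReal.rpow_ne_top_of_nonneg hp1.le (hck k)
    have hwk : ω (E ∩ A k) ≤ (2 ^ k * τ) ^ (-(p - 1)) * (B * N) := by
      rw [ENNReal.rpow_neg, mul_comm, ← div_eq_mul_inv,
        ENNReal.le_div_iff_mul_le (Or.inl hcp0) (Or.inl hcpt), mul_comm]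
      refine le_trans ?_ (rpow_mul_measure_wolffPotential_lt_le hp ω ν (hck k))
      gcongr
      exact inter_subset_right
    have hNe : N = J * τ ^ (p - 1) := by
      rw [hτp, ENNReal.mul_div_cancel hE0 hEt]
    calc (2 ^ (k + 1) * τ) ^ q * ω (E ∩ A k)
        ≤ (2 * (2 ^ k * τ)) ^ q * ((2 ^ k * τ) ^ (-(p - 1)) * (B * N)) := by
          rw [pow_succ', mul_assoc]; gcongr
      _ = 2 ^ q * ((2 ^ k * τ) ^ (q - (p - 1))) * (B * N) := by
          rw [ENNReal.mul_rpow_of_nonneg _ _ hq.le, sub_eq_add_neg q,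
            ENNReal.rpow_add _ _ (hck0 k) (hck k)]
          ring
      _ = 2 ^ q * ((2 ^ (q - (p - 1))) ^ k * τ ^ (q - (p - 1))) * (B * (J * τ ^ (p - 1))) := by
          rw [← hNe, ENNReal.mul_rpow_of_ne_top (by simp) hτt, ← ENNReal.rpow_natCast,
            ← ENNReal.rpow_natCast, ← ENNReal.rpow_mul, mul_comm (k : ℝ), ENNReal.rpow_mul]
      _ = 2 ^ q * B * ((τ ^ (q - (p - 1)) * τ ^ (p - 1)) * J) * (2 ^ (q - (p - 1))) ^ k := by
          ring
      _ = _ := by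
          rw [← ENNReal.rpow_add _ _ hτ0 hτt, sub_add_cancel]
  have hfin : τ ^ q * J = J ^ (1 - q / (p - 1)) * N ^ (q / (p - 1)) := by
    rw [hτ, ← ENNReal.rpow_mul, one_div_mul_eq_div, ENNReal.div_rpow_of_nonneg _ _ (by positivity),
      sub_eq_add_neg 1, ENNReal.rpow_add _ _ hE0 hEt, ENNReal.rpow_one, ENNReal.rpow_neg,
      div_eq_mul_inv]
    ring
  have hpos : ∀ x, wolffPotential n α p ω x ≠ 0 := fun x => (wolffPotential_pos hp hγ hω0 x).ne'
  calc ∫⁻ y in E, wolffPotential n α p ν y ^ q ∂σ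
      ≤ ∫⁻ y in E, (τ ^ q * wolffPotential n α p ω y ^ q +
          ∑' k : ℕ, (A k).indicator
            (fun y => (2 ^ (k + 1) * τ) ^ q * wolffPotential n α p ω y ^ q) y) ∂σ := by
        refine lintegral_mono fun y => ?_
        refine (rpow_le_dyadic_sum hq (hpos y) hτ0).trans (le_of_eq ?_)
        congr 1
        refine tsum_congr fun k => ?_
        simp only [indicator, hA, mem_ofPred_eq]
    _ = τ ^ q * ∫⁻ y in E, wolffPotential n α p ω y ^ q ∂σ +
          ∑' k : ℕ, (2 ^ (k + 1) * τ) ^ q *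
            ∫⁻ y in E ∩ A k, wolffPotential n α p ω y ^ q ∂σ := by
        have hm := hWω.pow_const q
        rw [lintegral_add_left (hm.const_mul _), lintegral_const_mul _ hm, lintegral_tsum]
        · congr 1
          refine tsum_congr fun k => ?_
          rw [lintegral_indicator (hAm k), lintegral_const_mul _ hm,
            Measure.restrict_restrict (hAm k), inter_comm]
        · exact fun k => ((hm.const_mul _).indicator (hAm k)).aemeasurable
    _ ≤ τ ^ q * J + ∑' k : ℕ, 2 ^ q * B * (τ ^ q * J) * (2 ^ (q - (p - 1))) ^ k := by
        refine add_le_add ?_ (ENNReal.tsum_le_tsum fun k => ?_)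
        · gcongr
          exact (hint E hE).trans hωE.le
        · refine le_trans ?_ (hterm k)
          gcongr
          exact hint _ (hE.inter (hAm k))
    _ = energyConst n α p q * (τ ^ q * J) := by
        rw [ENNReal.tsum_mul_left, ENNReal.tsum_geometric, energyConst]
        ring
    _ = _ := by rw [hfin]

/-- The energy estimate makes (C J^{1-q/(p-1)})^{1/q} admissible in the definition of κ(E); the
exponent q(p-1)/(p-1-q) is the one that turns the power of J into J itself. -/
theorem kappa_rpow_le (hp : 1 < p) (hγ : α * p ≤ n) (hq : 0 < q) (hqp : q < p - 1)
    {σ : Measure (EuclideanSpace ℝ (Fin n))} [SFinite σ]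
    {u : EuclideanSpace ℝ (Fin n) → ℝ≥0∞} (hum : AEMeasurable u σ)
    (hu : ∀ᵐ x ∂σ, wolffOp n α p q σ u x ≤ u x) (hu0 : ¬ ∀ᵐ x ∂σ, u x = 0)
    {E : Set (EuclideanSpace ℝ (Fin n))} (hE : MeasurableSet E)
    (hEt : ∫⁻ y in E, u y ^ q ∂σ ≠ ∞) :
    kappa n α p q σ E ^ (q * (p - 1) / (p - 1 - q)) ≤
      energyConst n α p q ^ ((p - 1) / (p - 1 - q)) * ∫⁻ y in E, u y ^ q ∂σ := by
  set J := ∫⁻ y in E, u y ^ q ∂σ with hJ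
  have hp1 : 0 < p - 1 := sub_pos.2 hp
  have hd : 0 < p - 1 - q := by linarith
  have hC := one_le_energyConst (n := n) (α := α) (p := p) (q := q)
  set C := energyConst n α p q with hCdef
  have hC0 : C ≠ 0 := (zero_lt_one.trans_le hC).ne'
  have hω0 : σ.withDensity (fun y => u y ^ q) ≠ 0 := by
    intro h
    apply hu0
    rw [withDensity_eq_zero_iff (hum.pow_const q)] at h
    filter_upwards [h] with x hx
    simpa [hq, hq.le, not_lt.2 hq.le] using hx
  have key : kappa n α p q σ E ≤ (C * J ^ (1 - q / (p - 1))) ^ (1 / q) := by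
    refine sInf_le fun ν hν => ?_
    rw [show (1 : ℝ) / (p - 1) = (q / (p - 1)) * (1 / q) by field_simp, ENNReal.rpow_mul (ν univ),
      ← ENNReal.mul_rpow_of_nonneg _ _ (by positivity)]
    refine ENNReal.rpow_le_rpow ?_ (by positivity)
    -- Here u = 0 almost everywhere on E, while u ≥ Wω > 0, so E is σ-null.
    by_cases hJ0 : J = 0
    · have : σ.restrict E = 0 := by
        rw [hJ, lintegral_eq_zero_iff' (hum.restrict.pow_const q)] at hJ0
        rw [← ae_eq_bot, ← Filter.eventually_false_iff_eq_bot]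
        filter_upwards [hJ0, ae_restrict_of_ae hu] with x hx hx2
        have h0 : u x = 0 := by simpa [hq, hq.le, not_lt.2 hq.le] using hx
        exact (wolffPotential_pos hp hγ hω0 x).ne' (le_antisymm (hx2.trans h0.le) bot_le)
      rw [this]; simp
    by_cases hνt : ν univ = ∞
    · rw [hνt, ENNReal.top_rpow_of_pos (by positivity), ENNReal.mul_top]
      · exact le_top
      · exact mul_ne_zero hC0 (ENNReal.rpow_pos (Ne.bot_lt hJ0) hEt).ne'
    by_cases hν0 : ν univ = 0
    · rw [Measure.measure_univ_eq_zero.1 hν0]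
      simp [wolffPotential_zero hp, ENNReal.zero_rpow_of_pos hq]
    rw [mul_assoc]
    exact lintegral_wolffPotential_rpow_le hp hγ hq hu hE hJ0 hEt hν0 hνt
  calc _ ≤ ((C * J ^ (1 - q / (p - 1))) ^ (1 / q)) ^ (q * (p - 1) / (p - 1 - q)) :=
        ENNReal.rpow_le_rpow key (by positivity)
    _ = C ^ ((p - 1) / (p - 1 - q)) * J := by
        rw [← ENNReal.rpow_mul, show 1 / q * (q * (p - 1) / (p - 1 - q)) = (p - 1) / (p - 1 - q) by
          field_simp, ENNReal.mul_rpow_of_nonneg _ _ (by positivity), ← ENNReal.rpow_mul,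
          show (1 - q / (p - 1)) * ((p - 1) / (p - 1 - q)) = 1 by field_simp, ENNReal.rpow_one]

/-- The lower bound of supersolutions by the intrinsic potential. -/
theorem intrinsicPotential_le_wolffOp (hp : 1 < p) (hγ : α * p ≤ n) (hq : 0 < q) (hqp : q < p - 1)
    {σ : Measure (EuclideanSpace ℝ (Fin n))} [SFinite σ]
    {u : EuclideanSpace ℝ (Fin n) → ℝ≥0∞} (hu : IsNontrivialWolffSupersolution n α p q σ u) (x) :
    intrinsicPotential n α p q σ x ≤
      (energyConst n α p q ^ ((p - 1) / (p - 1 - q))) ^ (1 / (p - 1)) *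
        wolffOp n α p q σ u x := by
  have hp1 : 0 < p - 1 := sub_pos.2 hp
  have hd : 0 < p - 1 - q := by linarith
  rw [intrinsicPotential, wolffOp, wolffPotential, ← wolffTail_const_mul hp
    (ENNReal.rpow_ne_top_of_nonneg (by positivity) (energyConst_ne_top hq hqp))]
  refine wolffTail_mono hp fun r _ => ?_
  rw [withDensity_apply _ Metric.isOpen_ball.measurableSet]
  exact kappa_rpow_le hp hγ hq hqp hu.memLqLoc.1 hu.le hu.nontrivial
    Metric.isOpen_ball.measurableSet (hu.memLqLoc.2 x r).ne

end WeakType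

/-! ### Lower bound by a power of the Wolff potential. -/

section LowerBound

theorem setLIntegral_le_of_forall_Ioi_le {f : ℝ → ℝ≥0∞} {S : Set ℝ} {b : ℝ≥0∞}
    (hbdd : BddBelow S) (h : ∀ t ∈ S, ∫⁻ r in Ioi t, f r ≤ b) : ∫⁻ r in S, f r ≤ b := by
  rcases S.eq_empty_or_nonempty with rfl | hne
  · simp
  have hU : Ioi (sInf S) = ⋃ k : ℕ, Ioi (sInf S + 1 / ((k : ℝ) + 1)) := by
    ext x
    simp only [mem_Ioi, mem_iUnion]
    constructor
    · intro hx
      obtain ⟨k, hk⟩ := exists_nat_one_div_lt (sub_pos.2 hx)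
      exact ⟨k, by linarith⟩
    · rintro ⟨k, hk⟩
      have : 0 < 1 / ((k : ℝ) + 1) := by positivity
      linarith
  have hmono : Monotone fun k : ℕ => Ioi (sInf S + 1 / ((k : ℝ) + 1)) := by
    intro i j hij
    refine Ioi_subset_Ioi (add_le_add_right ?_ _)
    exact one_div_le_one_div_of_le (by positivity) (by gcongr)
  calc ∫⁻ r in S, f r ≤ ∫⁻ r in Ici (sInf S), f r :=
        lintegral_mono_set fun x hx => csInf_le hbdd hx
    _ = ∫⁻ r in Ioi (sInf S), f r := setLIntegral_congr Ioi_ae_eq_Ici.symm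
    _ = ⨆ k : ℕ, ∫⁻ r in Ioi (sInf S + 1 / ((k : ℝ) + 1)), f r := by
        rw [hU, setLIntegral_iUnion_of_directed _ hmono.directed_le]
    _ ≤ b := by
        refine iSup_le fun k => ?_
        obtain ⟨t, ht, hlt⟩ := exists_lt_of_csInf_lt hne
          (lt_add_of_pos_right (sInf S) (by positivity : 0 < 1 / ((k : ℝ) + 1)))
        exact (lintegral_mono_set (Ioi_subset_Ioi hlt.le)).trans (h t ht)

/-- A crude form of ∫ F^β dF = F^{β+1}/(β+1) for the tail F, valid even when F is infinite. The
radii with F < m/2 carry mass at most m/2, so those with F ≥ m/2 carry at least m/2; truncation by M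
makes the subtraction legitimate. -/
theorem half_min_rpow_le_lintegral (f : ℝ → ℝ≥0∞) {M : ℝ≥0∞} (hM : M ≠ ∞) {β : ℝ} (hβ : 0 ≤ β) :
    (min (∫⁻ r in Ioi 0, f r) M / 2) ^ β * (min (∫⁻ r in Ioi 0, f r) M / 2) ≤
      ∫⁻ t in Ioi 0, min (∫⁻ r in Ioi t, f r) M ^ β * f t := by
  set F : ℝ → ℝ≥0∞ := fun t => ∫⁻ r in Ioi t, f r with hF
  set m := min (F 0) M with hm
  have hmt : m ≠ ∞ := ((min_le_right _ _).trans_lt hM.lt_top).ne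
  have hm2t : m / 2 ≠ ∞ := ENNReal.div_ne_top hmt (by norm_num)
  have hFanti : Antitone F := fun s t h => lintegral_mono_set (Ioi_subset_Ioi h)
  have hmeas : MeasurableSet {t | m / 2 ≤ F t} := hFanti.measurable measurableSet_Ici
  have hS : ∫⁻ r in Ioi 0 \ {t | m / 2 ≤ F t}, f r ≤ m / 2 :=
    setLIntegral_le_of_forall_Ioi_le ⟨0, fun t ht => (le_of_lt ht.1)⟩
      fun t ht => (not_le.1 ht.2).le
  have hT : m / 2 ≤ ∫⁻ r in Ioi 0 ∩ {t | m / 2 ≤ F t}, f r := by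
    have h1 : m / 2 + m / 2 ≤ (∫⁻ r in Ioi 0 ∩ {t | m / 2 ≤ F t}, f r) + m / 2 := by
      rw [ENNReal.add_halves]
      calc m ≤ F 0 := min_le_left _ _
        _ = (∫⁻ r in Ioi 0 ∩ {t | m / 2 ≤ F t}, f r) +
            ∫⁻ r in Ioi 0 \ {t | m / 2 ≤ F t}, f r :=
          (lintegral_inter_add_sdiff f _ hmeas).symm
        _ ≤ _ := by gcongr
    exact (ENNReal.add_le_add_iff_right hm2t).1 h1
  calc (m / 2) ^ β * (m / 2)
      ≤ (m / 2) ^ β * ∫⁻ r in Ioi 0 ∩ {t | m / 2 ≤ F t}, f r := by gcongr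
    _ = ∫⁻ r in Ioi 0 ∩ {t | m / 2 ≤ F t}, (m / 2) ^ β * f r :=
        (lintegral_const_mul' _ _ (ENNReal.rpow_ne_top_of_nonneg hβ hm2t)).symm
    _ ≤ ∫⁻ t in Ioi 0 ∩ {t | m / 2 ≤ F t}, min (F t) M ^ β * f t := by
        refine setLIntegral_mono' (measurableSet_Ioi.inter hmeas) fun t ht => ?_
        gcongr
        exact le_min ht.2 (ENNReal.half_le_self.trans (min_le_right _ _))
    _ ≤ _ := lintegral_mono_set inter_subset_left

variable {n : ℕ} {α p q : ℝ}

/-- The dilation constant of `wolffTail_comp_mul` for the factor two. -/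
noncomputable def dilationConst (n : ℕ) (α p : ℝ) : ℝ≥0∞ :=
  ENNReal.ofReal (2 ^ ((n : ℝ) - α * p)) ^ (1 / (p - 1))

theorem dilationConst_ne_top (hp : 1 < p) : dilationConst n α p ≠ ∞ :=
  ENNReal.rpow_ne_top_of_nonneg (one_div_sub_one_pos hp).le (by simp)

theorem one_le_dilationConst (hp : 1 < p) (hγ : α * p ≤ n) : 1 ≤ dilationConst n α p := by
  refine ENNReal.one_le_rpow ?_ (one_div_sub_one_pos hp)
  rw [ENNReal.one_le_ofReal]
  exact Real.one_le_rpow (by norm_num) (sub_nonneg.2 hγ)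

/-- Tails of potentials at comparable centres are comparable. -/
theorem wolffTail_le_of_comp_two (hp : 1 < p) {m m' : ℝ → ℝ≥0∞} {t : ℝ} (ht : 0 ≤ t)
    (h : ∀ r, t < r → m r ≤ m' (2 * r)) :
    wolffTail n α p m t ≤ dilationConst n α p * wolffTail n α p m' (2 * t) :=
  (wolffTail_mono hp h).trans (wolffTail_comp_mul hp two_pos ht).le

theorem wolffOp_const_mul (hp : 1 < p) (hq : 0 < q)
    {σ : Measure (EuclideanSpace ℝ (Fin n))} {u : EuclideanSpace ℝ (Fin n) → ℝ≥0∞}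
    {c : ℝ≥0∞} (hc : c ≠ ∞) (x) :
    wolffOp n α p q σ (fun y => c * u y) x = c ^ (q / (p - 1)) * wolffOp n α p q σ u x := by
  have hcq := ENNReal.rpow_ne_top_of_nonneg hq.le hc
  rw [wolffOp, wolffOp, wolffPotential, wolffPotential, div_eq_mul_one_div q, ENNReal.rpow_mul,
    ← wolffTail_const_mul hp hcq]
  congr 1
  ext r
  rw [withDensity_apply _ Metric.isOpen_ball.measurableSet,
    withDensity_apply _ Metric.isOpen_ball.measurableSet, ← lintegral_const_mul' _ _ hcq]
  exact lintegral_congr fun y => ENNReal.mul_rpow_of_nonneg _ _ hq.le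

theorem wolffOp_mono (hp : 1 < p) (hq : 0 < q) {σ : Measure (EuclideanSpace ℝ (Fin n))}
    {u v : EuclideanSpace ℝ (Fin n) → ℝ≥0∞} (h : ∀ x, u x ≤ v x) (x) :
    wolffOp n α p q σ u x ≤ wolffOp n α p q σ v x := by
  refine wolffPotential_mono hp (fun y r => ?_) x
  rw [withDensity_apply _ Metric.isOpen_ball.measurableSet,
    withDensity_apply _ Metric.isOpen_ball.measurableSet]
  exact lintegral_mono fun y => ENNReal.rpow_le_rpow (h y) hq.le

theorem wolffOp_restrict_le (hp : 1 < p) (hq : 0 < q) {σ : Measure (EuclideanSpace ℝ (Fin n))}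
    {u v : EuclideanSpace ℝ (Fin n) → ℝ≥0∞} {B : Set (EuclideanSpace ℝ (Fin n))}
    (h : ∀ᵐ x ∂σ.restrict B, v x ≤ u x) (x) :
    wolffOp n α p q (σ.restrict B) v x ≤ wolffOp n α p q σ u x := by
  refine wolffPotential_mono hp (fun y r => ?_) x
  rw [withDensity_apply _ Metric.isOpen_ball.measurableSet,
    withDensity_apply _ Metric.isOpen_ball.measurableSet]
  calc ∫⁻ y in Metric.ball y r, v y ^ q ∂σ.restrict B
      ≤ ∫⁻ y in Metric.ball y r, u y ^ q ∂σ.restrict B := by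
        refine lintegral_mono_ae (ae_restrict_of_ae ?_)
        filter_upwards [h] with z hz
        exact ENNReal.rpow_le_rpow hz hq.le
    _ ≤ _ := lintegral_mono' (Measure.restrict_mono_measure Measure.restrict_le_self _) le_rfl

/-- The constant in `min_wolffPotential_rpow_le`. -/
noncomputable def lowerConst (n : ℕ) (α p q : ℝ) : ℝ≥0∞ :=
  dilationConst n α p ^ ((p - 1) / (p - 1 - q) * q * (1 / (p - 1))) *
    2 ^ ((p - 1) / (p - 1 - q))

theorem lowerConst_ne_top (hp : 1 < p) (hq : 0 < q) (hqp : q < p - 1) :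
    lowerConst n α p q ≠ ∞ := by
  have hp1 : 0 < p - 1 := sub_pos.2 hp
  have hd : 0 < p - 1 - q := by linarith
  exact ENNReal.mul_ne_top (ENNReal.rpow_ne_top_of_nonneg (by positivity) (dilationConst_ne_top hp))
    (ENNReal.rpow_ne_top_of_nonneg (by positivity) (by simp))

theorem one_le_lowerConst (hp : 1 < p) (hγ : α * p ≤ n) (hq : 0 < q) (hqp : q < p - 1) :
    1 ≤ lowerConst n α p q := by
  have hp1 : 0 < p - 1 := sub_pos.2 hp
  have hd : 0 < p - 1 - q := by linarith
  exact one_le_mul (ENNReal.one_le_rpow (one_le_dilationConst hp hγ) (by positivity))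
    (ENNReal.one_le_rpow (by norm_num) (by positivity))

/-- For y in B(x,t) and r > t one has B(x,r) ⊂ B(y,2r), so the tail at x beyond t is at most D
Wσ(y). Hence ω(B(x,t)) dominates a multiple of min(F(t), M)^{δq} σ(B(x,t)), and
`half_min_rpow_le_lintegral` applies with β + 1 = δ. -/
theorem min_wolffPotential_rpow_le (hp : 1 < p) (hγ : α * p ≤ n) (hq : 0 < q) (hqp : q < p - 1)
    (σ : Measure (EuclideanSpace ℝ (Fin n))) {M : ℝ≥0∞} (hM : M ≠ ∞) (x) :
    min (wolffPotential n α p σ x) M ^ ((p - 1) / (p - 1 - q)) ≤ lowerConst n α p q *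
      wolffOp n α p q σ
        (fun y => min (wolffPotential n α p σ y) M ^ ((p - 1) / (p - 1 - q))) x := by
  have hp1 : 0 < p - 1 := sub_pos.2 hp
  have hd : 0 < p - 1 - q := by linarith
  have ha := one_div_sub_one_pos hp
  set δ := (p - 1) / (p - 1 - q) with hδ
  have hδ0 : 0 < δ := by positivity
  have hδ1 : δ * q * (1 / (p - 1)) + 1 = δ := by rw [hδ]; field_simp; ring
  set D := dilationConst n α p with hD
  have hD1 : 1 ≤ D := one_le_dilationConst hp hγ
  have hDt : D ≠ ∞ := dilationConst_ne_top hp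
  set F : ℝ → ℝ≥0∞ := fun t => wolffTail n α p (fun r => σ (Metric.ball x r)) t with hF
  set ω := σ.withDensity fun y => (min (wolffPotential n α p σ y) M ^ δ) ^ q with hω
  have hcmp : ∀ t, 0 < t → ∀ y ∈ Metric.ball x t,
      min (F t) M ≤ D * min (wolffPotential n α p σ y) M := by
    intro t ht y hy
    have h1 : F t ≤ D * wolffPotential n α p σ y := by
      refine (wolffTail_le_of_comp_two hp ht.le (m' := fun r => σ (Metric.ball y r))
        fun r hr => measure_mono (Metric.ball_subset_ball' ?_)).trans ?_
      · rw [Metric.mem_ball'] at hy; linarith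
      · gcongr
        exact wolffTail_anti (by positivity)
    rcases le_total (wolffPotential n α p σ y) M with h | h
    · rw [min_eq_left h]; exact (min_le_left _ _).trans h1
    · rw [min_eq_right h]
      exact (min_le_right _ _).trans ((one_mul M).symm.le.trans (mul_le_mul_left hD1 M))
  have hball : ∀ t, 0 < t →
      min (F t) M ^ (δ * q) * σ (Metric.ball x t) ≤ D ^ (δ * q) * ω (Metric.ball x t) := by
    intro t ht
    rw [hω, withDensity_apply _ Metric.isOpen_ball.measurableSet, ← setLIntegral_const,
      ← lintegral_const_mul' _ _ (ENNReal.rpow_ne_top_of_nonneg (by positivity) hDt)]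
    refine setLIntegral_mono' Metric.isOpen_ball.measurableSet fun y hy => ?_
    rw [← ENNReal.rpow_mul, ← ENNReal.mul_rpow_of_nonneg _ _ (by positivity)]
    exact ENNReal.rpow_le_rpow (hcmp t ht y hy) (by positivity)
  have hmain := half_min_rpow_le_lintegral (fun r =>
    (σ (Metric.ball x r) / ENNReal.ofReal (r ^ ((n : ℝ) - α * p))) ^ (1 / (p - 1)) /
      ENNReal.ofReal r) hM (β := δ * q * (1 / (p - 1))) (by positivity)
  have hint : ∫⁻ t in Ioi 0, min (F t) M ^ (δ * q * (1 / (p - 1))) *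
      ((σ (Metric.ball x t) / ENNReal.ofReal (t ^ ((n : ℝ) - α * p))) ^ (1 / (p - 1)) /
        ENNReal.ofReal t) ≤
      D ^ (δ * q * (1 / (p - 1))) * wolffPotential n α p ω x := by
    rw [ENNReal.rpow_mul D, wolffPotential, ← wolffTail_const_mul hp
      (ENNReal.rpow_ne_top_of_nonneg (by positivity) hDt)]
    refine setLIntegral_mono' measurableSet_Ioi fun t ht => ?_
    rw [ENNReal.rpow_mul, ← mul_div_assoc, ← ENNReal.mul_rpow_of_nonneg _ _ ha.le, ← mul_div_assoc]
    gcongr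
    exact hball t ht
  have hpow : ∀ m : ℝ≥0∞, m ≠ ∞ →
      m ^ δ = 2 ^ δ * ((m / 2) ^ (δ * q * (1 / (p - 1))) * (m / 2)) := by
    intro m hm
    have h2 : (m / 2) ^ (δ * q * (1 / (p - 1))) * (m / 2) = (m / 2) ^ δ := by
      conv_rhs => rw [← hδ1]
      rw [ENNReal.rpow_add_of_nonneg _ _ (by positivity) zero_le_one, ENNReal.rpow_one]
    rw [h2, ← ENNReal.mul_rpow_of_nonneg _ _ hδ0.le, ENNReal.mul_div_cancel (by simp) (by simp)]
  have hmt : min (wolffPotential n α p σ x) M ≠ ∞ := ((min_le_right _ _).trans_lt hM.lt_top).ne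
  calc _ = 2 ^ δ * _ := hpow _ hmt
    _ ≤ 2 ^ δ * _ := mul_le_mul_right (hmain.trans hint) _
    _ = lowerConst n α p q * wolffPotential n α p ω x := by
      rw [lowerConst, ← mul_assoc, mul_comm (2 ^ δ)]

theorem wolffPotential_restrict_ball_iSup (hp : 1 < p)
    (σ : Measure (EuclideanSpace ℝ (Fin n))) (x) :
    wolffPotential n α p σ x = ⨆ k : ℕ, wolffPotential n α p (σ.restrict (Metric.ball 0 k)) x := by
  simp only [wolffPotential]
  have hmono : Monotone fun k : ℕ => Metric.ball (0 : EuclideanSpace ℝ (Fin n)) k :=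
    fun i j h => Metric.ball_subset_ball (by exact_mod_cast h)
  rw [← wolffTail_iSup hp]
  · congr 1
    ext r
    simp only [Measure.restrict_apply Metric.isOpen_ball.measurableSet]
    rw [← Directed.measure_iUnion, ← inter_iUnion, Metric.iUnion_ball_nat, inter_univ]
    exact Monotone.directed_le fun i j h => inter_subset_inter_right _ (hmono h)
  · exact fun k => (monotone_measure_ball _ x).measurable
  · intro i j h r
    exact Measure.restrict_mono (hmono h) le_rfl _

/-- If c V ≤ Wω on B, applying the operator once gives c^{q/(p-1)} V ≤ L Wω everywhere. The supremum
of admissible c is positive and admissible, so this self-improvement bounds it below by a constant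
independent of u, R and M. -/
theorem min_wolffPotential_restrict_le_wolffOp (hp : 1 < p) (hγ : α * p ≤ n) (hq : 0 < q)
    (hqp : q < p - 1) {σ : Measure (EuclideanSpace ℝ (Fin n))}
    {u : EuclideanSpace ℝ (Fin n) → ℝ≥0∞} (hu : ∀ᵐ x ∂σ, wolffOp n α p q σ u x ≤ u x)
    {R : ℝ} (hR : 0 < R) (hωR : ∫⁻ y in Metric.ball 0 R, u y ^ q ∂σ ≠ 0)
    {M : ℝ≥0∞} (hM0 : M ≠ 0) (hM : M ≠ ∞) (x) :
    min (wolffPotential n α p (σ.restrict (Metric.ball 0 R)) x) M ^ ((p - 1) / (p - 1 - q)) ≤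
      lowerConst n α p q ^ ((p - 1) / (p - 1 - q)) * wolffOp n α p q σ u x := by
  have hp1 : 0 < p - 1 := sub_pos.2 hp
  have hd : 0 < p - 1 - q := by linarith
  have ha := one_div_sub_one_pos hp
  have hL1 := one_le_lowerConst (n := n) hp hγ hq hqp
  have hLt := lowerConst_ne_top (n := n) (α := α) hp hq hqp
  set L := lowerConst n α p q with hL
  have hL0 : L ≠ 0 := (zero_lt_one.trans_le hL1).ne'
  set δ := (p - 1) / (p - 1 - q) with hδ
  have hδ0 : 0 < δ := by positivity
  have hδ1 : δ * (1 - q / (p - 1)) = 1 := by rw [hδ]; field_simp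
  set B := Metric.ball (0 : EuclideanSpace ℝ (Fin n)) R with hB
  set V : EuclideanSpace ℝ (Fin n) → ℝ≥0∞ :=
    fun y => min (wolffPotential n α p (σ.restrict B) y) M ^ δ with hV
  have hMδ0 : M ^ δ ≠ 0 := (ENNReal.rpow_pos hM0.bot_lt hM).ne'
  have hMδt : M ^ δ ≠ ∞ := ENNReal.rpow_ne_top_of_nonneg hδ0.le hM
  have hVM : ∀ y, V y ≤ M ^ δ := fun y => ENNReal.rpow_le_rpow (min_le_right _ _) hδ0.le
  have hstep : ∀ c : ℝ≥0∞, c ≠ ∞ → (∀ y ∈ B, c * V y ≤ wolffOp n α p q σ u y) →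
      ∀ y, c ^ (q / (p - 1)) * V y ≤ L * wolffOp n α p q σ u y := by
    intro c hc h y
    have h1 : wolffOp n α p q (σ.restrict B) (fun y => c * V y) y ≤ wolffOp n α p q σ u y := by
      refine wolffOp_restrict_le hp hq ?_ y
      filter_upwards [ae_restrict_of_ae hu, ae_restrict_mem Metric.isOpen_ball.measurableSet]
        with z hz hzB
      exact (h z hzB).trans hz
    rw [wolffOp_const_mul hp hq hc] at h1
    calc c ^ (q / (p - 1)) * V y
        ≤ c ^ (q / (p - 1)) * (L * wolffOp n α p q (σ.restrict B) V y) := by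
          gcongr
          exact min_wolffPotential_rpow_le hp hγ hq hqp _ hM y
      _ = L * (c ^ (q / (p - 1)) * wolffOp n α p q (σ.restrict B) V y) := by ring
      _ ≤ L * wolffOp n α p q σ u y := by gcongr
  set S : Set ℝ≥0∞ := {c | ∀ y ∈ B, c * V y ≤ wolffOp n α p q σ u y} with hS
  have hstar : ∀ y ∈ B, sSup S * V y ≤ wolffOp n α p q σ u y := by
    intro y hy
    rw [ENNReal.sSup_mul]
    exact iSup₂_le fun c hc => hc y hy
  have hSpos : 0 < sSup S := by
    set ω := σ.withDensity fun y => u y ^ q with hω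
    have hωB : ω B ≠ 0 := by rwa [hω, withDensity_apply _ Metric.isOpen_ball.measurableSet]
    -- A lower bound for Wω on B: every y in B has B ⊂ B(y,2R), and radii just above 2R already
    -- contribute this much. Since V ≤ M^δ, the multiple cR/M^δ is admissible.
    set cR := (ω B / ENNReal.ofReal ((2 * (2 * R)) ^ ((n : ℝ) - α * p))) ^ (1 / (p - 1)) / 2
    have hcR : 0 < cR := ENNReal.div_pos (ENNReal.rpow_pos_of_nonneg
      (ENNReal.div_pos hωB (by simp)) ha.le).ne' (by simp)
    have hmem : cR / M ^ δ ∈ S := by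
      intro y hy
      calc cR / M ^ δ * V y ≤ cR / M ^ δ * M ^ δ := by gcongr; exact hVM y
        _ = cR := ENNReal.div_mul_cancel hMδ0 hMδt
        _ ≤ (ω (Metric.ball y (2 * R)) / ENNReal.ofReal ((2 * (2 * R)) ^ ((n : ℝ) - α * p))) ^
            (1 / (p - 1)) / 2 := by
          have : B ⊆ Metric.ball y (2 * R) := by
            refine Metric.ball_subset_ball' ?_
            rw [Metric.mem_ball'] at hy; linarith
          simp only [cR]
          gcongr
        _ ≤ _ := (le_wolffTail hp hγ (monotone_measure_ball ω y) (by positivity)).trans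
            (wolffTail_anti (by positivity))
    exact (ENNReal.div_pos hcR.ne' hMδt).trans_le (le_sSup hmem)
  have hbig : (L ^ δ)⁻¹ ≤ sSup S := by
    by_cases ht : sSup S = ∞
    · rw [ht]; exact le_top
    have h1 : sSup S ^ (q / (p - 1)) / L ≤ sSup S := by
      refine le_sSup fun y hy => ?_
      have := hstep _ ht hstar y
      rw [ENNReal.mul_div_right_comm.symm, ENNReal.div_le_iff_le_mul (Or.inl hL0) (Or.inl hLt),
        mul_comm _ L]
      exact this
    have h2 : L⁻¹ ≤ sSup S ^ (1 - q / (p - 1)) := by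
      rw [sub_eq_add_neg 1, ENNReal.rpow_add _ _ hSpos.ne' ht, ENNReal.rpow_one, ENNReal.rpow_neg,
        ← div_eq_mul_inv, ENNReal.le_div_iff_mul_le
          (Or.inl (ENNReal.rpow_pos hSpos ht).ne')
          (Or.inl (ENNReal.rpow_ne_top_of_nonneg (by positivity) ht)), mul_comm,
        ← div_eq_mul_inv]
      exact h1
    calc (L ^ δ)⁻¹ = (L⁻¹) ^ δ := (ENNReal.inv_rpow _ _).symm
      _ ≤ (sSup S ^ (1 - q / (p - 1))) ^ δ := ENNReal.rpow_le_rpow h2 hδ0.le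
      _ = sSup S := by rw [← ENNReal.rpow_mul, mul_comm, hδ1, ENNReal.rpow_one]
  have hLδ0 : L ^ δ ≠ 0 := (ENNReal.rpow_pos hL0.bot_lt hLt).ne'
  have hLδt : L ^ δ ≠ ∞ := ENNReal.rpow_ne_top_of_nonneg hδ0.le hLt
  -- One more application of the operator carries the inequality from B to every point.
  have hfin := hstep (L ^ δ)⁻¹ (ENNReal.inv_ne_top.2 hLδ0) (fun y hy =>
    (mul_le_mul_left hbig _).trans (hstar y hy)) x
  have hexp : L ^ δ = L ^ (δ * (q / (p - 1))) * L := by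
    conv_rhs => rw [← ENNReal.rpow_one L, ← ENNReal.rpow_mul, one_mul]
    rw [← ENNReal.rpow_add _ _ hL0 hLt]
    congr 1
    linarith
  rw [← ENNReal.rpow_neg, ← ENNReal.rpow_mul, neg_mul, ENNReal.rpow_neg] at hfin
  have hc0 : L ^ (δ * (q / (p - 1))) ≠ 0 := (ENNReal.rpow_pos hL0.bot_lt hLt).ne'
  have hct : L ^ (δ * (q / (p - 1))) ≠ ∞ := ENNReal.rpow_ne_top_of_nonneg (by positivity) hLt
  calc V x = L ^ (δ * (q / (p - 1))) * ((L ^ (δ * (q / (p - 1))))⁻¹ * V x) := by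
        rw [← mul_assoc, ENNReal.mul_inv_cancel hc0 hct, one_mul]
    _ ≤ L ^ (δ * (q / (p - 1))) * (L * wolffOp n α p q σ u x) := by gcongr
    _ = _ := by rw [hexp, mul_assoc]

/-- The lower bound of supersolutions by a power of the Wolff potential. -/
theorem wolffPotential_rpow_le_wolffOp (hp : 1 < p) (hγ : α * p ≤ n) (hq : 0 < q)
    (hqp : q < p - 1) {σ : Measure (EuclideanSpace ℝ (Fin n))}
    {u : EuclideanSpace ℝ (Fin n) → ℝ≥0∞} (hu : IsNontrivialWolffSupersolution n α p q σ u) (x) :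
    wolffPotential n α p σ x ^ ((p - 1) / (p - 1 - q)) ≤
      lowerConst n α p q ^ ((p - 1) / (p - 1 - q)) * wolffOp n α p q σ u x := by
  have hp1 : 0 < p - 1 := sub_pos.2 hp
  have hd : 0 < p - 1 - q := by linarith
  have hω0 : σ.withDensity (fun y => u y ^ q) ≠ 0 := by
    intro h
    apply hu.nontrivial
    rw [withDensity_eq_zero_iff (hu.memLqLoc.1.pow_const q)] at h
    filter_upwards [h] with x hx
    simpa [hq, hq.le, not_lt.2 hq.le] using hx
  obtain ⟨k₀, hk₀⟩ := exists_measure_ball_pos hω0 (0 : EuclideanSpace ℝ (Fin n))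
  set δ := (p - 1) / (p - 1 - q) with hδ
  have hδ0 : 0 < δ := by positivity
  set Y := lowerConst n α p q ^ δ * wolffOp n α p q σ u x with hY
  have hk : ∀ k : ℕ, k₀ ≤ k → k ≠ 0 →
      min (wolffPotential n α p (σ.restrict (Metric.ball 0 k)) x) k ≤ Y ^ δ⁻¹ := by
    intro k hk hk0
    rw [ENNReal.le_rpow_inv_iff hδ0]
    refine min_wolffPotential_restrict_le_wolffOp hp hγ hq hqp hu.le (by positivity) ?_
      (by simpa using hk0) (by simp) x
    rw [← withDensity_apply _ Metric.isOpen_ball.measurableSet]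
    exact (hk₀.trans_le (monotone_measure_ball _ _ (by exact_mod_cast hk))).ne'
  rw [← ENNReal.le_rpow_inv_iff hδ0, wolffPotential_restrict_ball_iSup hp]
  refine iSup_le fun j => ?_
  by_cases ht : Y ^ δ⁻¹ = ∞
  · rw [ht]; exact le_top
  obtain ⟨k, hkY⟩ := ENNReal.exists_nat_gt ht
  -- The ball of radius K contains the one of radius j and is charged by ω, and the truncation level
  -- K exceeds the target, so the cap cannot be the active term.
  set K := max (max j k) (max k₀ 1) with hK
  have h1 := hk K ((le_max_left _ _).trans (le_max_right _ _))
    (by have : 1 ≤ K := (le_max_right _ _).trans (le_max_right _ _)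
        omega)
  have hKY : Y ^ δ⁻¹ < K := hkY.trans_le
    (by exact_mod_cast (le_max_right j k).trans (le_max_left _ _))
  rcases min_le_iff.1 h1 with h2 | h2
  · refine le_trans (wolffPotential_mono hp (fun y r => ?_) x) h2
    refine Measure.restrict_mono (Metric.ball_subset_ball ?_) le_rfl _
    exact_mod_cast (le_max_left j k).trans (le_max_left _ _)
  · exact absurd h2 (not_le.2 hKY)

end LowerBound

/-! ### Monotone iteration and energy of the limit. -/

section Existence

variable {n : ℕ} {α p q : ℝ} {σ : Measure (EuclideanSpace ℝ (Fin n))}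

/-- Iterates of `u ↦ W_{α,p} (u^q dσ)`, starting from a bounded subsolution. -/
noncomputable def wolffIter (n : ℕ) (α p q : ℝ) (σ : Measure (EuclideanSpace ℝ (Fin n))) :
    ℕ → EuclideanSpace ℝ (Fin n) → ℝ≥0∞
  | 0 => fun x => (lowerConst n α p q ^ ((p - 1) / (p - 1 - q)))⁻¹ *
      min (wolffPotential n α p σ x) 1 ^ ((p - 1) / (p - 1 - q))
  | k + 1 => wolffOp n α p q σ (wolffIter n α p q σ k)

/-- The limit of the iterates. -/
noncomputable def wolffSol (n : ℕ) (α p q : ℝ) (σ : Measure (EuclideanSpace ℝ (Fin n)))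
    (x : EuclideanSpace ℝ (Fin n)) : ℝ≥0∞ :=
  ⨆ k, wolffIter n α p q σ k x

theorem measurable_wolffOp [SFinite σ] {u : EuclideanSpace ℝ (Fin n) → ℝ≥0∞} :
    Measurable (wolffOp n α p q σ u) :=
  measurable_wolffPotential

theorem measurable_wolffIter [SFinite σ] (k : ℕ) : Measurable (wolffIter n α p q σ k) := by
  cases k with
  | zero =>
    exact ((measurable_wolffPotential.min measurable_const).pow_const _).const_mul _
  | succ k => exact measurable_wolffOp

theorem measurable_wolffSol [SFinite σ] : Measurable (wolffSol n α p q σ) :=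
  Measurable.iSup measurable_wolffIter

theorem wolffIter_zero_le_one (hp : 1 < p) (hγ : α * p ≤ n) (hq : 0 < q) (hqp : q < p - 1) (x) :
    wolffIter n α p q σ 0 x ≤ 1 := by
  have hp1 : 0 < p - 1 := sub_pos.2 hp
  have hd : 0 < p - 1 - q := by linarith
  refine mul_le_one' (ENNReal.inv_le_one.2 (ENNReal.one_le_rpow
    (one_le_lowerConst hp hγ hq hqp) (by positivity))) ?_
  exact ENNReal.rpow_le_one (min_le_right _ _) (by positivity)

theorem wolffIter_zero_le_rpow (hp : 1 < p) (hγ : α * p ≤ n) (hq : 0 < q) (hqp : q < p - 1) (x) :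
    wolffIter n α p q σ 0 x ≤ wolffPotential n α p σ x ^ ((p - 1) / (p - 1 - q)) := by
  have hp1 : 0 < p - 1 := sub_pos.2 hp
  have hd : 0 < p - 1 - q := by linarith
  refine mul_le_of_le_one_of_le (ENNReal.inv_le_one.2 (ENNReal.one_le_rpow
    (one_le_lowerConst hp hγ hq hqp) (by positivity))) ?_
  exact ENNReal.rpow_le_rpow (min_le_left _ _) (by positivity)

/-- The factor L^{-δ} in the starting function is the fixed point of c ↦ c^{q/(p-1)}/L, so it
exactly absorbs the loss L in `min_wolffPotential_rpow_le`. -/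
theorem wolffIter_zero_le (hp : 1 < p) (hγ : α * p ≤ n) (hq : 0 < q) (hqp : q < p - 1) (x) :
    wolffIter n α p q σ 0 x ≤ wolffIter n α p q σ 1 x := by
  have hp1 : 0 < p - 1 := sub_pos.2 hp
  have hd : 0 < p - 1 - q := by linarith
  have hL1 := one_le_lowerConst (n := n) hp hγ hq hqp
  have hLt := lowerConst_ne_top (n := n) (α := α) hp hq hqp
  have hmin := min_wolffPotential_rpow_le (n := n) hp hγ hq hqp σ (M := 1) (by simp) x
  simp only [wolffIter]
  set L := lowerConst n α p q with hL
  set δ := (p - 1) / (p - 1 - q) with hδ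
  have hδ0 : 0 < δ := by positivity
  have hL0 : L ≠ 0 := (zero_lt_one.trans_le hL1).ne'
  have hLδ0 : L ^ δ ≠ 0 := (ENNReal.rpow_pos hL0.bot_lt hLt).ne'
  have hexp : -δ = -δ * (q / (p - 1)) + -1 := by rw [hδ]; field_simp; ring
  rw [wolffOp_const_mul hp hq (ENNReal.inv_ne_top.2 hLδ0), ← ENNReal.rpow_neg, ← ENNReal.rpow_mul]
  nth_rw 1 [hexp]
  rw [ENNReal.rpow_add _ _ hL0 hLt, mul_assoc]
  gcongr
  rw [ENNReal.rpow_neg_one, mul_comm, ← div_eq_mul_inv]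
  exact ENNReal.div_le_of_le_mul' hmin

theorem monotone_wolffIter (hp : 1 < p) (hγ : α * p ≤ n) (hq : 0 < q) (hqp : q < p - 1) :
    Monotone (wolffIter n α p q σ) := by
  refine monotone_nat_of_le_succ fun k => ?_
  induction k with
  | zero => exact wolffIter_zero_le hp hγ hq hqp
  | succ k ih => exact wolffOp_mono hp hq ih

theorem iSup_rpow {ι : Type*} (f : ι → ℝ≥0∞) (hq : 0 < q) : (⨆ i, f i) ^ q = ⨆ i, f i ^ q := by
  simpa only [ENNReal.orderIsoRpow_apply] using (ENNReal.orderIsoRpow q hq).map_iSup f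

theorem wolffOp_iSup (hp : 1 < p) (hq : 0 < q) {u : ℕ → EuclideanSpace ℝ (Fin n) → ℝ≥0∞}
    (hu : ∀ k, Measurable (u k)) (hmono : Monotone u) (x) :
    wolffOp n α p q σ (fun y => ⨆ k, u k y) x = ⨆ k, wolffOp n α p q σ (u k) x := by
  simp only [wolffOp, wolffPotential]
  rw [← wolffTail_iSup hp]
  · congr 1
    ext r
    simp only [withDensity_apply _ Metric.isOpen_ball.measurableSet, iSup_rpow _ hq]
    rw [lintegral_iSup (fun k => (hu k).pow_const q)]
    exact fun i j h y => ENNReal.rpow_le_rpow (hmono h y) hq.le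
  · exact fun k => (monotone_measure_ball _ x).measurable
  · intro i j h r
    simp only [withDensity_apply _ Metric.isOpen_ball.measurableSet]
    exact lintegral_mono fun y => ENNReal.rpow_le_rpow (hmono h y) hq.le

/-- Monotone convergence passes the recursion to the limit; this holds in [0, ∞] without any
integrability. -/
theorem wolffSol_eq [SFinite σ] (hp : 1 < p) (hγ : α * p ≤ n) (hq : 0 < q) (hqp : q < p - 1) (x) :
    wolffSol n α p q σ x = wolffOp n α p q σ (wolffSol n α p q σ) x := by
  have hmono := monotone_wolffIter (σ := σ) hp hγ hq hqp
  have hmono' : Monotone fun k => wolffIter n α p q σ k x := fun i j h => hmono h x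
  have h1 := wolffOp_iSup (n := n) (α := α) (σ := σ) hp hq measurable_wolffIter hmono x
  exact (hmono'.iSup_nat_add 1).symm.trans h1.symm

theorem wolffSol_pos (hp : 1 < p) (hγ : α * p ≤ n) (hq : 0 < q) (hqp : q < p - 1) (hσ : σ ≠ 0)
    (x) : 0 < wolffSol n α p q σ x := by
  have hp1 : 0 < p - 1 := sub_pos.2 hp
  have hd : 0 < p - 1 - q := by linarith
  refine lt_of_lt_of_le ?_ (le_iSup (fun k => wolffIter n α p q σ k x) 0)
  simp only [wolffIter]
  refine ENNReal.mul_pos ?_ ?_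
  · exact ENNReal.inv_ne_zero.2 (ENNReal.rpow_ne_top_of_nonneg (by positivity)
      (lowerConst_ne_top hp hq hqp))
  · exact (ENNReal.rpow_pos_of_nonneg
      (lt_min (wolffPotential_pos hp hγ hσ x) zero_lt_one) (by positivity)).ne'

theorem wolffSol_le (hp : 1 < p) (hq : 0 < q) {h : EuclideanSpace ℝ (Fin n) → ℝ≥0∞}
    (h0 : ∀ x, wolffIter n α p q σ 0 x ≤ h x) (h1 : ∀ x, wolffOp n α p q σ h x ≤ h x) (x) :
    wolffSol n α p q σ x ≤ h x := by
  have key : ∀ k x, wolffIter n α p q σ k x ≤ h x := by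
    intro k
    induction k with
    | zero => exact h0
    | succ k ih => exact fun x => (wolffOp_mono hp hq ih x).trans (h1 x)
  exact iSup_le fun k => key k x

/-- The energies I_k satisfy I_k ≤ I_{k+1} ≤ K^q I_k^{q/(p-1)}. For finite K each is finite, since
the start is bounded and σ is finite, so the sublinear power can be absorbed on the left. -/
theorem lintegral_wolffSol_rpow_le [IsFiniteMeasure σ] (hp : 1 < p) (hγ : α * p ≤ n) (hq : 0 < q)
    (hqp : q < p - 1) {K : ℝ≥0∞}
    (hK : ∀ ν : Measure (EuclideanSpace ℝ (Fin n)), IsFiniteMeasure ν →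
      (∫⁻ y, wolffPotential n α p ν y ^ q ∂σ) ^ (1 / q) ≤ K * ν univ ^ (1 / (p - 1))) :
    ∫⁻ y, wolffSol n α p q σ y ^ q ∂σ ≤ K ^ (q * (p - 1) / (p - 1 - q)) := by
  have hp1 : 0 < p - 1 := sub_pos.2 hp
  have hd : 0 < p - 1 - q := by linarith
  by_cases hKt : K = ∞
  · rw [hKt, ENNReal.top_rpow_of_pos (by positivity)]; exact le_top
  have hmono := monotone_wolffIter (σ := σ) hp hγ hq hqp
  have hstep : ∀ k, ∫⁻ y, wolffIter n α p q σ k y ^ q ∂σ ≠ ∞ →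
      ∫⁻ y, wolffIter n α p q σ (k + 1) y ^ q ∂σ ≤
        K ^ q * (∫⁻ y, wolffIter n α p q σ k y ^ q ∂σ) ^ (q / (p - 1)) := by
    intro k hk
    have := hK (σ.withDensity fun y => wolffIter n α p q σ k y ^ q)
      (isFiniteMeasure_withDensity hk)
    rw [withDensity_apply _ MeasurableSet.univ, Measure.restrict_univ] at this
    have h2 := ENNReal.rpow_le_rpow this hq.le
    rwa [← ENNReal.rpow_mul, one_div_mul_cancel hq.ne', ENNReal.rpow_one,
      ENNReal.mul_rpow_of_nonneg _ _ hq.le, ← ENNReal.rpow_mul, one_div_mul_eq_div] at h2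
  have hfin : ∀ k, ∫⁻ y, wolffIter n α p q σ k y ^ q ∂σ ≠ ∞ := by
    intro k
    induction k with
    | zero =>
      refine ((lintegral_mono fun y => ENNReal.rpow_le_one
        (wolffIter_zero_le_one hp hγ hq hqp y) hq.le).trans_lt ?_).ne
      simp
    | succ k ih =>
      exact ((hstep k ih).trans_lt (ENNReal.mul_lt_top
        (ENNReal.rpow_lt_top_of_nonneg hq.le hKt)
        (ENNReal.rpow_lt_top_of_nonneg (by positivity) ih))).ne
  have hbound : ∀ k, ∫⁻ y, wolffIter n α p q σ k y ^ q ∂σ ≤ K ^ (q * (p - 1) / (p - 1 - q)) := by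
    intro k
    have h1 : ∫⁻ y, wolffIter n α p q σ k y ^ q ∂σ ≤
        ∫⁻ y, wolffIter n α p q σ (k + 1) y ^ q ∂σ :=
      lintegral_mono fun y => ENNReal.rpow_le_rpow (hmono k.le_succ y) hq.le
    have h2 := h1.trans (hstep k (hfin k))
    have hft := hfin k
    set I := ∫⁻ y, wolffIter n α p q σ k y ^ q ∂σ
    by_cases hI0 : I = 0
    · rw [hI0]; exact bot_le
    have h3 : I ^ (1 - q / (p - 1)) ≤ K ^ q := by
      rw [sub_eq_add_neg 1, ENNReal.rpow_add _ _ hI0 hft, ENNReal.rpow_one, ENNReal.rpow_neg,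
        ← div_eq_mul_inv]
      exact ENNReal.div_le_of_le_mul h2
    calc I = (I ^ (1 - q / (p - 1))) ^ ((p - 1) / (p - 1 - q)) := by
          rw [← ENNReal.rpow_mul, show (1 - q / (p - 1)) * ((p - 1) / (p - 1 - q)) = 1 by
            field_simp, ENNReal.rpow_one]
      _ ≤ (K ^ q) ^ ((p - 1) / (p - 1 - q)) := ENNReal.rpow_le_rpow h3 (by positivity)
      _ = _ := by rw [← ENNReal.rpow_mul, mul_div_assoc]
  simp only [wolffSol, iSup_rpow _ hq]
  rw [lintegral_iSup (fun k => (measurable_wolffIter k).pow_const q)]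
  · exact iSup_le hbound
  · exact fun i j h y => ENNReal.rpow_le_rpow (hmono h y) hq.le

theorem lintegral_wolffPotential_le_kappa (hp : 1 < p) (hq : 0 < q)
    (E : Set (EuclideanSpace ℝ (Fin n))) (ν : Measure (EuclideanSpace ℝ (Fin n)))
    [IsFiniteMeasure ν] :
    (∫⁻ y in E, wolffPotential n α p ν y ^ q ∂σ) ^ (1 / q) ≤
      kappa n α p q σ E * ν univ ^ (1 / (p - 1)) := by
  have ha := one_div_sub_one_pos hp
  by_cases h0 : ν univ = 0
  · rw [Measure.measure_univ_eq_zero.1 h0]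
    simp [wolffPotential_zero hp, ENNReal.zero_rpow_of_pos hq, hq]
  have hc0 : ν univ ^ (1 / (p - 1)) ≠ 0 :=
    (ENNReal.rpow_pos_of_nonneg (Ne.bot_lt h0) ha.le).ne'
  have hct : ν univ ^ (1 / (p - 1)) ≠ ∞ :=
    ENNReal.rpow_ne_top_of_nonneg ha.le (measure_ne_top _ _)
  rw [← ENNReal.div_le_iff hc0 hct]
  exact le_sInf fun k hk => ENNReal.div_le_of_le_mul (hk ν inferInstance)

theorem lintegral_wolffSol_restrict_rpow_le (hp : 1 < p) (hγ : α * p ≤ n) (hq : 0 < q)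
    (hqp : q < p - 1) {B : Set (EuclideanSpace ℝ (Fin n))} (hB : σ B ≠ ∞) :
    ∫⁻ y in B, wolffSol n α p q (σ.restrict B) y ^ q ∂σ ≤
      kappa n α p q σ B ^ (q * (p - 1) / (p - 1 - q)) := by
  have : IsFiniteMeasure (σ.restrict B) := isFiniteMeasure_restrict.2 hB
  exact lintegral_wolffSol_rpow_le hp hγ hq hqp
    fun ν _ => lintegral_wolffPotential_le_kappa hp hq B ν

/-- Makes both lower bounds available for the local solution, which is how lower estimates are
turned into the upper one. -/
theorem isNontrivialWolffSupersolution_wolffSol_restrict [SFinite σ] (hp : 1 < p)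
    (hγ : α * p ≤ n) (hq : 0 < q) (hqp : q < p - 1) {B : Set (EuclideanSpace ℝ (Fin n))}
    (hB : σ B ≠ ∞) (hB0 : σ.restrict B ≠ 0) (hκ : kappa n α p q σ B ≠ ∞) :
    IsNontrivialWolffSupersolution n α p q (σ.restrict B) (wolffSol n α p q (σ.restrict B)) := by
  have hp1 : 0 < p - 1 := sub_pos.2 hp
  have hd : 0 < p - 1 - q := by linarith
  refine ⟨⟨measurable_wolffSol.aemeasurable, fun x r => ?_⟩, ?_, ?_⟩
  · refine (setLIntegral_le_lintegral _ _).trans_lt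
      ((lintegral_wolffSol_restrict_rpow_le hp hγ hq hqp hB).trans_lt ?_)
    exact ENNReal.rpow_lt_top_of_nonneg (by positivity) hκ
  · exact Eventually.of_forall fun x => (wolffSol_eq hp hγ hq hqp x).symm.le
  · intro h
    apply hB0
    rw [← ae_eq_bot, ← Filter.eventually_false_iff_eq_bot]
    filter_upwards [h] with x hx
    exact (wolffSol_pos hp hγ hq hqp hB0 x).ne' hx

end Existence

/-! ### The bound as a supersolution, and the upper estimate. -/

section UpperBound

variable {n : ℕ} {α p q : ℝ} {σ : Measure (EuclideanSpace ℝ (Fin n))}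

theorem kappa_mono (hq : 0 < q) {E E' : Set (EuclideanSpace ℝ (Fin n))} (h : E ⊆ E') :
    kappa n α p q σ E ≤ kappa n α p q σ E' := by
  refine sInf_le_sInf fun k hk ν hν => le_trans ?_ (hk ν hν)
  exact ENNReal.rpow_le_rpow (lintegral_mono_set h) (by positivity)

theorem monotone_kappaPow (hp : 1 < p) (hq : 0 < q) (hqp : q < p - 1) (x) :
    Monotone (kappaPow n α p q σ x) := by
  have hp1 : 0 < p - 1 := sub_pos.2 hp
  have hd : 0 < p - 1 - q := by linarith
  exact fun r s h => ENNReal.rpow_le_rpow (kappa_mono hq (Metric.ball_subset_ball h))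
    (by positivity)

theorem kappa_restrict {B E : Set (EuclideanSpace ℝ (Fin n))} (hE : MeasurableSet E)
    (hEB : E ⊆ B) : kappa n α p q (σ.restrict B) E = kappa n α p q σ E := by
  simp only [kappa, Measure.restrict_restrict hE, inter_eq_self_of_subset_left hEB]

theorem wolffTail_zero_le_add (hp : 1 < p) {m m' m'' : ℝ → ℝ≥0∞} {t : ℝ} (ht : 0 ≤ t)
    (h1 : ∀ r, 0 < r → r ≤ t → m r ≤ m' r) (h2 : ∀ r, t < r → m r ≤ m'' (2 * r)) :
    wolffTail n α p m 0 ≤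
      wolffTail n α p m' 0 + dilationConst n α p * wolffTail n α p m'' (2 * t) := by
  have ha := (one_div_sub_one_pos hp).le
  rw [wolffTail, ← Ioc_union_Ioi_eq_Ioi ht, lintegral_union measurableSet_Ioi
    (Ioc_disjoint_Ioi le_rfl)]
  refine add_le_add ?_ (wolffTail_le_of_comp_two hp ht h2)
  refine le_trans ?_ (lintegral_mono_set (show Ioc 0 t ⊆ Ioi 0 from Ioc_subset_Ioi_self))
  refine setLIntegral_mono' measurableSet_Ioc fun r hr => ?_
  gcongr
  exact h1 r hr.1 hr.2

/-- `K_{α,p} σ + (W_{α,p} σ)^((p-1)/(p-1-q))` with the potentials replaced by their tails. -/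
noncomputable def tailBound (n : ℕ) (α p q : ℝ) (σ : Measure (EuclideanSpace ℝ (Fin n)))
    (x : EuclideanSpace ℝ (Fin n)) (T : ℝ) : ℝ≥0∞ :=
  wolffTail n α p (kappaPow n α p q σ x) T +
    wolffTail n α p (fun r => σ (Metric.ball x r)) T ^ ((p - 1) / (p - 1 - q))

/-- The constant in `wolffBound_le_of_mem_ball`. -/
noncomputable def localConst (n : ℕ) (α p q : ℝ) : ℝ≥0∞ :=
  ((energyConst n α p q ^ ((p - 1) / (p - 1 - q))) ^ (1 / (p - 1)) + dilationConst n α p) +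
    2 ^ ((p - 1) / (p - 1 - q)) * (lowerConst n α p q ^ ((p - 1) / (p - 1 - q)) +
      dilationConst n α p ^ ((p - 1) / (p - 1 - q)))

theorem localConst_ne_top (hp : 1 < p) (hq : 0 < q) (hqp : q < p - 1) :
    localConst n α p q ≠ ∞ := by
  have hp1 : 0 < p - 1 := sub_pos.2 hp
  have hd : 0 < p - 1 - q := by linarith
  have hδ : 0 ≤ (p - 1) / (p - 1 - q) := by positivity
  have h1 := ENNReal.rpow_ne_top_of_nonneg (one_div_sub_one_pos hp).le
    (ENNReal.rpow_ne_top_of_nonneg hδ (energyConst_ne_top (n := n) (α := α) hq hqp))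
  have h2 := dilationConst_ne_top (n := n) (α := α) hp
  have h3 := ENNReal.rpow_ne_top_of_nonneg hδ (lowerConst_ne_top (n := n) (α := α) hp hq hqp)
  have h4 := ENNReal.rpow_ne_top_of_nonneg hδ h2
  have h5 := ENNReal.rpow_ne_top_of_nonneg hδ (x := 2) (by simp)
  exact ENNReal.add_ne_top.2 ⟨ENNReal.add_ne_top.2 ⟨h1, h2⟩,
    ENNReal.mul_ne_top h5 (ENNReal.add_ne_top.2 ⟨h3, h4⟩)⟩

theorem one_le_localConst (hp : 1 < p) (hγ : α * p ≤ n) : 1 ≤ localConst n α p q :=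
  (one_le_dilationConst hp hγ).trans (le_add_self.trans le_self_add)

/-- For r ≤ t the ball B(y,r) lies in B(x,2t), so these radii see only the restricted measure and
are controlled by the local solution. For r > t it lies in B(x,2r), which gives tails at x. -/
theorem wolffBound_le_of_mem_ball [SFinite σ] (hp : 1 < p) (hγ : α * p ≤ n) (hq : 0 < q)
    (hqp : q < p - 1) {x y : EuclideanSpace ℝ (Fin n)} {t T : ℝ} (hT : 0 ≤ T) (hTt : T < t)
    (hy : y ∈ Metric.ball x t)
    (hσ : σ (Metric.ball x (2 * t)) ≠ ∞) (hσ0 : σ.restrict (Metric.ball x (2 * t)) ≠ 0)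
    (hκ : kappa n α p q σ (Metric.ball x (2 * t)) ≠ ∞) :
    wolffBound n α p q σ y ≤ localConst n α p q *
      (wolffSol n α p q (σ.restrict (Metric.ball x (2 * t))) y + tailBound n α p q σ x T) := by
  have hp1 : 0 < p - 1 := sub_pos.2 hp
  have hd : 0 < p - 1 - q := by linarith
  have ht : 0 ≤ t := hT.trans hTt.le
  have hyx : dist y x < t := hy
  have hsol := isNontrivialWolffSupersolution_wolffSol_restrict hp hγ hq hqp hσ hσ0 hκ
  set B := Metric.ball x (2 * t) with hB
  set U := wolffSol n α p q (σ.restrict B) y with hU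
  have hUeq : wolffOp n α p q (σ.restrict B) (wolffSol n α p q (σ.restrict B)) y = U :=
    (wolffSol_eq hp hγ hq hqp y).symm
  have hK' := intrinsicPotential_le_wolffOp hp hγ hq hqp hsol y
  have hW' := wolffPotential_rpow_le_wolffOp hp hγ hq hqp hsol y
  rw [hUeq] at hK' hW'
  set δ := (p - 1) / (p - 1 - q) with hδ
  have hδ0 : 0 < δ := by positivity
  set D := dilationConst n α p with hD
  set C₁ := (energyConst n α p q ^ δ) ^ (1 / (p - 1)) with hC₁
  set C₂ := lowerConst n α p q ^ δ with hC₂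
  set G := wolffTail n α p (kappaPow n α p q σ x) T with hG
  set F := wolffTail n α p (fun r => σ (Metric.ball x r)) T with hF
  have hin : ∀ r, r ≤ t → Metric.ball y r ⊆ B := fun r hr =>
    Metric.ball_subset_ball' (by linarith)
  have hout : ∀ r, t < r → Metric.ball y r ⊆ Metric.ball x (2 * r) := fun r hr =>
    Metric.ball_subset_ball' (by linarith)
  have hK : intrinsicPotential n α p q σ y ≤ C₁ * U + D * G := by
    refine (wolffTail_zero_le_add hp ht (m' := kappaPow n α p q (σ.restrict B) y)
      (m'' := kappaPow n α p q σ x) (fun r _ hr => ?_) (fun r hr => ?_)).trans ?_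
    · simp only [kappaPow]
      rw [kappa_restrict Metric.isOpen_ball.measurableSet (hin r hr)]
    · exact ENNReal.rpow_le_rpow (kappa_mono hq (hout r hr)) (by positivity)
    · refine add_le_add hK' ?_
      gcongr
      exact wolffTail_anti (by linarith)
  have hW : wolffPotential n α p σ y ≤ wolffPotential n α p (σ.restrict B) y + D * F := by
    refine (wolffTail_zero_le_add hp ht (m' := fun r => σ.restrict B (Metric.ball y r))
      (m'' := fun r => σ (Metric.ball x r)) (fun r _ hr => ?_) (fun r hr => ?_)).trans ?_
    · rw [Measure.restrict_apply Metric.isOpen_ball.measurableSet,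
        inter_eq_self_of_subset_left (hin r hr)]
    · exact measure_mono (hout r hr)
    · refine add_le_add le_rfl ?_
      gcongr
      exact wolffTail_anti (by linarith)
  have hWδ : wolffPotential n α p σ y ^ δ ≤ 2 ^ δ * (C₂ * U + D ^ δ * F ^ δ) := by
    refine (ENNReal.rpow_le_rpow hW hδ0.le).trans
      ((ENNReal.add_rpow_le_two_rpow_mul hδ0.le _ _).trans ?_)
    rw [ENNReal.mul_rpow_of_nonneg _ _ hδ0.le]
    gcongr
  have hGH : G ≤ tailBound n α p q σ x T := le_self_add
  have hFH : F ^ δ ≤ tailBound n α p q σ x T := le_add_self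
  set H := tailBound n α p q σ x T
  calc wolffBound n α p q σ y ≤ (C₁ * U + D * G) + 2 ^ δ * (C₂ * U + D ^ δ * F ^ δ) :=
        add_le_add hK hWδ
    _ ≤ (C₁ * (U + H) + D * (U + H)) + 2 ^ δ * (C₂ * (U + H) + D ^ δ * (U + H)) := by
        gcongr
        · exact le_self_add
        · exact hGH.trans le_add_self
        · exact le_self_add
        · exact hFH.trans le_add_self
    _ = localConst n α p q * (U + H) := by
        rw [localConst]; ring

/-- The tail term is constant on the ball, and the energy of the local solution on B(x,2t) is
bounded by the power of κ. -/
theorem lintegral_ball_wolffBound_rpow_le [IsLocallyFiniteMeasure σ] (hp : 1 < p) (hγ : α * p ≤ n)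
    (hq : 0 < q) (hqp : q < p - 1) (x : EuclideanSpace ℝ (Fin n)) {t T : ℝ} (hT : 0 ≤ T)
    (hTt : T < t) :
    ∫⁻ y in Metric.ball x t, wolffBound n α p q σ y ^ q ∂σ ≤
      (localConst n α p q ^ q * 2 ^ q) * (tailBound n α p q σ x T ^ q * σ (Metric.ball x t) +
        kappaPow n α p q σ x (2 * t)) := by
  have hp1 : 0 < p - 1 := sub_pos.2 hp
  have hd : 0 < p - 1 - q := by linarith
  have hC1 := one_le_localConst (n := n) (q := q) hp hγ
  have hCt := localConst_ne_top (n := n) (α := α) hp hq hqp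
  have hsub : Metric.ball x t ⊆ Metric.ball x (2 * t) := Metric.ball_subset_ball (by linarith)
  have hσ : σ (Metric.ball x (2 * t)) ≠ ∞ := measure_ball_lt_top.ne
  by_cases hκ : kappa n α p q σ (Metric.ball x (2 * t)) = ∞
  · rw [kappaPow, hκ, ENNReal.top_rpow_of_pos (by positivity), add_top, ENNReal.mul_top]
    · exact le_top
    · exact mul_ne_zero (ENNReal.rpow_pos (zero_lt_one.trans_le hC1) hCt).ne'
        (ENNReal.rpow_pos two_pos ENNReal.ofNat_ne_top).ne'
  by_cases hσ0 : σ.restrict (Metric.ball x (2 * t)) = 0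
  · refine (lintegral_mono_set hsub).trans ?_
    rw [hσ0]; simp
  set B := Metric.ball x (2 * t) with hB
  set H := tailBound n α p q σ x T with hH
  set U := wolffSol n α p q (σ.restrict B) with hU
  have hpt : ∀ y ∈ Metric.ball x t, wolffBound n α p q σ y ^ q ≤
      (localConst n α p q ^ q * 2 ^ q) * (H ^ q + U y ^ q) := by
    intro y hy
    calc wolffBound n α p q σ y ^ q ≤ (localConst n α p q * (H + U y)) ^ q := by
          rw [add_comm]
          exact ENNReal.rpow_le_rpow
            (wolffBound_le_of_mem_ball hp hγ hq hqp hT hTt hy hσ hσ0 hκ) hq.le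
      _ ≤ _ := by
          rw [ENNReal.mul_rpow_of_nonneg _ _ hq.le, mul_assoc]
          gcongr
          exact ENNReal.add_rpow_le_two_rpow_mul hq.le _ _
  have hC2t : localConst n α p q ^ q * 2 ^ q ≠ ∞ :=
    ENNReal.mul_ne_top (ENNReal.rpow_ne_top_of_nonneg hq.le hCt)
      (ENNReal.rpow_ne_top_of_nonneg hq.le (by simp))
  refine (setLIntegral_mono' Metric.isOpen_ball.measurableSet hpt).trans ?_
  rw [lintegral_const_mul' _ _ hC2t, lintegral_add_left measurable_const, setLIntegral_const]
  gcongr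
  exact (lintegral_mono_set hsub).trans
    (lintegral_wolffSol_restrict_rpow_le hp hγ hq hqp hσ)

/-- The constant in `wolffTail_wolffBound_le`. -/
noncomputable def upperConst (n : ℕ) (α p q : ℝ) : ℝ≥0∞ :=
  (localConst n α p q ^ q * 2 ^ q) ^ (1 / (p - 1)) *
    (2 ^ (1 / (p - 1)) * (1 + dilationConst n α p))

theorem upperConst_ne_top (hp : 1 < p) (hq : 0 < q) (hqp : q < p - 1) :
    upperConst n α p q ≠ ∞ := by
  have ha := one_div_sub_one_pos hp
  refine ENNReal.mul_ne_top (ENNReal.rpow_ne_top_of_nonneg ha.le (ENNReal.mul_ne_top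
    (ENNReal.rpow_ne_top_of_nonneg hq.le (localConst_ne_top hp hq hqp))
    (ENNReal.rpow_ne_top_of_nonneg hq.le (by simp)))) (ENNReal.mul_ne_top
    (ENNReal.rpow_ne_top_of_nonneg ha.le (by simp))
    (ENNReal.add_ne_top.2 ⟨by simp, dilationConst_ne_top hp⟩))

theorem one_le_upperConst (hp : 1 < p) (hγ : α * p ≤ n) (hq : 0 < q) :
    1 ≤ upperConst n α p q := by
  have ha := one_div_sub_one_pos hp
  refine one_le_mul (ENNReal.one_le_rpow (one_le_mul (ENNReal.one_le_rpow
    (one_le_localConst hp hγ) hq) (ENNReal.one_le_rpow (by norm_num) hq)) ha)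
    (one_le_mul (ENNReal.one_le_rpow (by norm_num) ha) le_self_add)

/-- The tail H at level T bounds that at every larger radius, so it factors out of the integral.
Since F^δ ≤ H, the mixed term H^{q/(p-1)} F is at most H. The case T = 0 gives the supersolution
property, T = 1 the finiteness needed for existence. -/
theorem wolffTail_wolffBound_le [IsLocallyFiniteMeasure σ] (hp : 1 < p) (hγ : α * p ≤ n)
    (hq : 0 < q) (hqp : q < p - 1) (x : EuclideanSpace ℝ (Fin n)) {T : ℝ} (hT : 0 ≤ T) :
    wolffTail n α p
        (fun r => (σ.withDensity fun y => wolffBound n α p q σ y ^ q) (Metric.ball x r)) T ≤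
      upperConst n α p q * tailBound n α p q σ x T := by
  have hp1 : 0 < p - 1 := sub_pos.2 hp
  have hd : 0 < p - 1 - q := by linarith
  have ha := one_div_sub_one_pos hp
  have hC1 := one_le_upperConst (n := n) (q := q) hp hγ hq
  have hCt : localConst n α p q ^ q * 2 ^ q ≠ ∞ :=
    ENNReal.mul_ne_top (ENNReal.rpow_ne_top_of_nonneg hq.le (localConst_ne_top hp hq hqp))
      (ENNReal.rpow_ne_top_of_nonneg hq.le (by simp))
  by_cases hHt : tailBound n α p q σ x T = ∞
  · rw [hHt, ENNReal.mul_top (zero_lt_one.trans_le hC1).ne']; exact le_top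
  set H := tailBound n α p q σ x T with hH
  set D := dilationConst n α p with hD
  set G := wolffTail n α p (kappaPow n α p q σ x) T with hG
  set F := wolffTail n α p (fun r => σ (Metric.ball x r)) T with hF
  have hGH : G ≤ H := le_self_add
  have hFH : F ≤ H ^ ((p - 1 - q) / (p - 1)) := by
    have : F ^ ((p - 1) / (p - 1 - q)) ≤ H := le_add_self
    have := (ENNReal.le_rpow_inv_iff (by positivity)).2 this
    rwa [inv_div] at this
  have hHF : (H ^ q) ^ (1 / (p - 1)) * F ≤ H := by
    calc (H ^ q) ^ (1 / (p - 1)) * F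
        ≤ (H ^ q) ^ (1 / (p - 1)) * H ^ ((p - 1 - q) / (p - 1)) := by gcongr
      _ = H ^ (q * (1 / (p - 1)) + (p - 1 - q) / (p - 1)) := by
          rw [← ENNReal.rpow_mul, ENNReal.rpow_add_of_nonneg _ _ (by positivity) (by positivity)]
      _ = H := by
          rw [show q * (1 / (p - 1)) + (p - 1 - q) / (p - 1) = 1 by field_simp; ring,
            ENNReal.rpow_one]
  have hHq : H ^ q ≠ ∞ := ENNReal.rpow_ne_top_of_nonneg hq.le hHt
  calc _ ≤ wolffTail n α p (fun r => (localConst n α p q ^ q * 2 ^ q) *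
          (H ^ q * σ (Metric.ball x r) + kappaPow n α p q σ x (2 * r))) T := by
        refine wolffTail_mono hp fun r hr => ?_
        rw [withDensity_apply _ Metric.isOpen_ball.measurableSet]
        exact lintegral_ball_wolffBound_rpow_le hp hγ hq hqp x hT hr
    _ ≤ (localConst n α p q ^ q * 2 ^ q) ^ (1 / (p - 1)) * (2 ^ (1 / (p - 1)) *
          ((H ^ q) ^ (1 / (p - 1)) * F + D * G)) := by
        rw [wolffTail_const_mul hp hCt]
        gcongr
        refine (wolffTail_add_le hp
          ((monotone_measure_ball σ x).measurable.const_mul _)).trans ?_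
        rw [wolffTail_const_mul hp hHq]
        gcongr
        refine (wolffTail_le_of_comp_two hp hT fun r _ => le_rfl).trans ?_
        gcongr
        exact wolffTail_anti (by linarith)
    _ ≤ (localConst n α p q ^ q * 2 ^ q) ^ (1 / (p - 1)) * (2 ^ (1 / (p - 1)) *
          (H + D * H)) := by gcongr
    _ = upperConst n α p q * H := by rw [upperConst]; ring

theorem wolffOp_wolffBound_le [IsLocallyFiniteMeasure σ] (hp : 1 < p) (hγ : α * p ≤ n)
    (hq : 0 < q) (hqp : q < p - 1) (x : EuclideanSpace ℝ (Fin n)) :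
    wolffOp n α p q σ (wolffBound n α p q σ) x ≤ upperConst n α p q * wolffBound n α p q σ x :=
  wolffTail_wolffBound_le hp hγ hq hqp x le_rfl

/-- The multiple C^δ is large enough because δ q/(p-1) + 1 = δ; the resulting supersolution lies
above the starting function, hence above all iterates. -/
theorem wolffSol_le_wolffBound [IsLocallyFiniteMeasure σ] (hp : 1 < p) (hγ : α * p ≤ n)
    (hq : 0 < q) (hqp : q < p - 1) (x : EuclideanSpace ℝ (Fin n)) :
    wolffSol n α p q σ x ≤
      upperConst n α p q ^ ((p - 1) / (p - 1 - q)) * wolffBound n α p q σ x := by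
  have hp1 : 0 < p - 1 := sub_pos.2 hp
  have hd : 0 < p - 1 - q := by linarith
  have hC1 := one_le_upperConst (n := n) (q := q) hp hγ hq
  have hCt := upperConst_ne_top (n := n) (α := α) hp hq hqp
  set C := upperConst n α p q with hC
  set δ := (p - 1) / (p - 1 - q) with hδ
  have hδ0 : 0 < δ := by positivity
  have hCδ1 : 1 ≤ C ^ δ := ENNReal.one_le_rpow hC1 hδ0
  have hCδt : C ^ δ ≠ ∞ := ENNReal.rpow_ne_top_of_nonneg hδ0.le hCt
  have hexp : δ * (q / (p - 1)) + 1 = δ := by rw [hδ]; field_simp; ring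
  refine wolffSol_le (h := fun y => C ^ δ * wolffBound n α p q σ y) hp hq (fun y => ?_)
    (fun y => ?_) x
  · calc wolffIter n α p q σ 0 y ≤ wolffPotential n α p σ y ^ δ :=
          wolffIter_zero_le_rpow hp hγ hq hqp y
      _ ≤ 1 * wolffBound n α p q σ y := by rw [one_mul]; exact le_add_self
      _ ≤ _ := by gcongr
  · rw [wolffOp_const_mul hp hq hCδt]
    calc (C ^ δ) ^ (q / (p - 1)) * wolffOp n α p q σ (wolffBound n α p q σ) y
        ≤ (C ^ δ) ^ (q / (p - 1)) * (C * wolffBound n α p q σ y) := by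
          gcongr
          exact wolffOp_wolffBound_le hp hγ hq hqp y
      _ = C ^ δ * wolffBound n α p q σ y := by
          rw [← ENNReal.rpow_mul, ← mul_assoc]
          nth_rw 2 [← ENNReal.rpow_one C]
          rw [← ENNReal.rpow_add_of_nonneg _ _ (by positivity) zero_le_one, hexp]

end UpperBound

/-! ### Vanishing lower limit at infinity. -/

section Infinity

variable {n : ℕ} {α p q : ℝ}

/-- Were every point of the ball bad, the covering estimate against Lebesgue measure would give
2ω(ℝⁿ) ≤ ω(ℝⁿ); the threshold t is chosen for this contradiction. -/
theorem exists_mem_ball_measure_ball_le (hn : 0 < n) (ω : Measure (EuclideanSpace ℝ (Fin n)))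
    [IsFiniteMeasure ω] (z : EuclideanSpace ℝ (Fin n)) {R : ℝ} (hR : 0 < R) :
    ∃ x ∈ Metric.ball z R, ∀ r : ℝ, 0 < r →
      ω (Metric.ball x r) ≤ ENNReal.ofReal (2 * (6 * r) ^ n / R ^ n) * ω univ := by
  have : Nonempty (Fin n) := ⟨⟨0, hn⟩⟩
  have hvol : ∀ (x : EuclideanSpace ℝ (Fin n)) {r : ℝ}, 0 ≤ r → volume (Metric.ball x r) =
      ENNReal.ofReal (r ^ n) * volume (Metric.ball (0 : EuclideanSpace ℝ (Fin n)) 1) := by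
    intro x r hr
    rw [Measure.addHaar_ball volume x hr, finrank_euclideanSpace_fin]
  set v := volume (Metric.ball (0 : EuclideanSpace ℝ (Fin n)) 1) with hv
  have hv0 : v ≠ 0 := (Metric.measure_ball_pos _ _ one_pos).ne'
  have hvt : v ≠ ∞ := measure_ball_lt_top.ne
  by_cases hN : ω univ = 0
  · refine ⟨z, Metric.mem_ball_self hR, fun r _ => ?_⟩
    exact (measure_mono (subset_univ _)).trans (hN.le.trans bot_le)
  have hRn : ENNReal.ofReal (R ^ n) ≠ 0 := by
    have : 0 < R ^ n := by positivity
    simpa using this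
  set V := ENNReal.ofReal (R ^ n) * v with hV
  have hV0 : V ≠ 0 := mul_ne_zero hRn hv0
  have hVt : V ≠ ∞ := ENNReal.mul_ne_top (by simp) hvt
  set t := 2 * ω univ / V with ht
  have hVit := mul_measure_ratio_le (volume : Measure (EuclideanSpace ℝ (Fin n))) ω t
  by_contra! hcon
  have hsub : Metric.ball z R ⊆
      {x | ∃ r : ℝ, 0 < r ∧ t * volume (Metric.ball x (6 * r)) < ω (Metric.ball x r)} := by
    intro x hx
    obtain ⟨r, hr, hlt⟩ := hcon x hx
    refine ⟨r, hr, lt_of_le_of_lt (le_of_eq ?_) hlt⟩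
    rw [hvol x (by positivity), ENNReal.ofReal_div_of_pos (by positivity),
      ENNReal.ofReal_mul (by norm_num), ht, hV, div_eq_mul_inv, div_eq_mul_inv,
      ENNReal.mul_inv (Or.inl hRn) (Or.inr hv0), ENNReal.ofReal_ofNat]
    calc 2 * ω univ * ((ENNReal.ofReal (R ^ n))⁻¹ * v⁻¹) * (ENNReal.ofReal ((6 * r) ^ n) * v)
        = 2 * ENNReal.ofReal ((6 * r) ^ n) * (ENNReal.ofReal (R ^ n))⁻¹ * ω univ * (v⁻¹ * v) := by
          ring
      _ = _ := by rw [ENNReal.inv_mul_cancel hv0 hvt, mul_one]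
  have h1 : t * V ≤ ω univ := by
    refine le_trans ?_ hVit
    gcongr
    rw [hV, ← hvol z hR.le]
    exact measure_mono hsub
  rw [ht, ENNReal.div_mul_cancel hV0 hVt, two_mul] at h1
  exact (ENNReal.lt_add_right (measure_ne_top ω univ) hN).not_ge h1

theorem lintegral_Ioc_rpow {R s : ℝ} (hR : 0 ≤ R) (hs : 0 < s) :
    ∫⁻ r in Ioc 0 R, ENNReal.ofReal (r ^ (s - 1)) = ENNReal.ofReal (R ^ s / s) := by
  have hint : IntervalIntegrable (fun r : ℝ => r ^ (s - 1)) volume 0 R :=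
    intervalIntegral.intervalIntegrable_rpow' (by linarith)
  rw [← ofReal_integral_eq_lintegral_ofReal
    ((intervalIntegrable_iff_integrableOn_Ioc_of_le hR).1 hint),
    ← intervalIntegral.integral_of_le hR, integral_rpow (Or.inl (by linarith)), sub_add_cancel,
    Real.zero_rpow hs.ne', sub_zero]
  filter_upwards [ae_restrict_mem measurableSet_Ioc] with r hr
  exact Real.rpow_nonneg hr.1.le _

/-- The constant in `exists_wolffPotential_le_wolffTail`. -/
noncomputable def decayConst (n : ℕ) (α p : ℝ) : ℝ≥0∞ :=
  2 * ENNReal.ofReal ((2 * 6 ^ n * 8 ^ ((n : ℝ) - α * p)) ^ (1 / (p - 1)) /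
    (α * p * (1 / (p - 1)))) + ENNReal.ofReal (4 ^ ((n : ℝ) - α * p)) ^ (1 / (p - 1))

theorem decayConst_ne_top (hp : 1 < p) : decayConst n α p ≠ ∞ :=
  ENNReal.add_ne_top.2 ⟨ENNReal.mul_ne_top (by simp) (by simp),
    ENNReal.rpow_ne_top_of_nonneg (one_div_sub_one_pos hp).le (by simp)⟩

/-- Choose x within R of a point of norm 2R, so R ≤ ‖x‖ < 3R, with density control for ω restricted
to B(0,4R). Radii up to R then integrate r^{αp/(p-1)-1}, which converges at 0; for larger radii
B(x,r) ⊂ B(0,4r). -/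
theorem exists_wolffPotential_le_wolffTail (hn : 0 < n) (hp : 1 < p) (hα : 0 < α)
    (hγ : α * p ≤ n) (ω : Measure (EuclideanSpace ℝ (Fin n))) {R : ℝ} (hR : 0 < R)
    (hω : ω (Metric.ball 0 (4 * R)) ≠ ∞) :
    ∃ x : EuclideanSpace ℝ (Fin n), R ≤ ‖x‖ ∧ wolffPotential n α p ω x ≤
      decayConst n α p * wolffTail n α p (fun r => ω (Metric.ball 0 r)) (4 * R) := by
  have ha := one_div_sub_one_pos hp
  set a := 1 / (p - 1) with ha_def
  have : Nonempty (Fin n) := ⟨⟨0, hn⟩⟩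
  obtain ⟨z, hz⟩ := NormedSpace.exists_lt_norm ℝ (EuclideanSpace ℝ (Fin n)) 0
  obtain ⟨z, hz⟩ : ∃ z : EuclideanSpace ℝ (Fin n), ‖z‖ = 2 * R :=
    ⟨(2 * R / ‖z‖) • z, by rw [norm_smul, Real.norm_of_nonneg (by positivity),
      div_mul_cancel₀ _ hz.ne']⟩
  have hfin : IsFiniteMeasure (ω.restrict (Metric.ball 0 (4 * R))) := isFiniteMeasure_restrict.2 hω
  obtain ⟨x, hxz, hx⟩ := exists_mem_ball_measure_ball_le hn
    (ω.restrict (Metric.ball 0 (4 * R))) z hR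
  rw [Measure.restrict_apply_univ] at hx
  rw [mem_ball_iff_norm] at hxz
  have hx1 : R ≤ ‖x‖ := by
    have := norm_sub_norm_le z x
    rw [norm_sub_rev] at this
    linarith
  have hx2 : ‖x‖ < 3 * R := by
    have := norm_sub_norm_le x z
    linarith
  refine ⟨x, hx1, ?_⟩
  set N := ω (Metric.ball 0 (4 * R)) with hN
  have hsmall : ∀ r, 0 < r → r ≤ R →
      ω (Metric.ball x r) ≤ ENNReal.ofReal (2 * (6 * r) ^ n / R ^ n) * N := by
    intro r h0 hr
    refine le_trans (le_of_eq ?_) (hx r h0)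
    rw [Measure.restrict_apply Metric.isOpen_ball.measurableSet, inter_eq_self_of_subset_left]
    refine Metric.ball_subset_ball' ?_
    rw [dist_zero_right]; linarith
  have hlarge : ∀ r, R < r → ω (Metric.ball x r) ≤ ω (Metric.ball 0 (4 * r)) := by
    intro r hr
    refine measure_mono (Metric.ball_subset_ball' ?_)
    rw [dist_zero_right]; linarith
  set Z := wolffTail n α p (fun r => ω (Metric.ball 0 r)) (4 * R) with hZ
  -- The mass in B(0,4R) is itself controlled by the tail beyond 4R, so the near part is absorbed as
  -- well.
  have hNZ : N ^ a ≤ 2 * ENNReal.ofReal (((8 * R) ^ ((n : ℝ) - α * p)) ^ a) * Z := by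
    have h1 := le_wolffTail (n := n) hp hγ
      (monotone_measure_ball ω (0 : EuclideanSpace ℝ (Fin n))) (t := 4 * R) (by positivity)
    have h2 : (0 : ℝ) < (8 * R) ^ ((n : ℝ) - α * p) := by positivity
    rw [← hN, ← ha_def, ENNReal.div_rpow_of_nonneg _ _ ha.le,
      show 2 * (4 * R) = 8 * R by ring, ENNReal.ofReal_rpow_of_pos h2,
      ENNReal.div_le_iff (by simp) (by simp), ENNReal.div_le_iff] at h1
    · calc N ^ a ≤ _ := h1
        _ = _ := by ring
    · have : 0 < ((8 * R) ^ ((n : ℝ) - α * p)) ^ a := by positivity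
      simpa using this
    · simp
  have hs : 0 < α * p * a := by positivity
  have hnear : ∫⁻ r in Ioc 0 R, (ω (Metric.ball x r) / ENNReal.ofReal (r ^ ((n : ℝ) - α * p))) ^ a /
      ENNReal.ofReal r ≤
      ENNReal.ofReal ((2 * 6 ^ n / R ^ n) ^ a * (R ^ (α * p * a) / (α * p * a))) * N ^ a := by
    have hNt : N ^ a ≠ ∞ := ENNReal.rpow_ne_top_of_nonneg ha.le hω
    rw [ENNReal.ofReal_mul (by positivity), ← lintegral_Ioc_rpow hR.le hs, mul_comm _ (N ^ a),
      ← mul_assoc,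
      ← lintegral_const_mul' _ _ (ENNReal.mul_ne_top hNt (by simp))]
    refine setLIntegral_mono' measurableSet_Ioc fun r hr => ?_
    have hr0 : 0 < r := hr.1
    calc (ω (Metric.ball x r) / ENNReal.ofReal (r ^ ((n : ℝ) - α * p))) ^ a / ENNReal.ofReal r
        ≤ (ENNReal.ofReal (2 * (6 * r) ^ n / R ^ n) * N / ENNReal.ofReal (r ^ ((n : ℝ) - α * p))) ^ a
            / ENNReal.ofReal r := by
          gcongr
          exact hsmall r hr.1 hr.2
      _ = (N * ENNReal.ofReal (2 * 6 ^ n / R ^ n * r ^ (α * p))) ^ a / ENNReal.ofReal r := by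
          rw [mul_comm _ N, mul_div_assoc, ← ENNReal.ofReal_div_of_pos (by positivity)]
          congr 4
          rw [Real.rpow_sub hr0, Real.rpow_natCast, mul_pow]
          field_simp
      _ = N ^ a * ENNReal.ofReal ((2 * 6 ^ n / R ^ n) ^ a) * ENNReal.ofReal (r ^ (α * p * a - 1)) := by
          rw [ENNReal.mul_rpow_of_nonneg _ _ ha.le, mul_div_assoc, mul_assoc,
            ENNReal.ofReal_rpow_of_pos (by positivity), ← ENNReal.ofReal_div_of_pos hr0,
            ← ENNReal.ofReal_mul (by positivity), Real.mul_rpow (by positivity) (by positivity),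
            ← Real.rpow_mul hr0.le, Real.rpow_sub_one hr0.ne', mul_div_assoc]
  have hfar : wolffTail n α p (fun r => ω (Metric.ball x r)) R ≤
      ENNReal.ofReal (4 ^ ((n : ℝ) - α * p)) ^ a * Z :=
    (wolffTail_mono hp hlarge).trans
      (wolffTail_comp_mul (m := fun r => ω (Metric.ball 0 r)) hp (by norm_num) hR.le).le
  have hconst : (2 * 6 ^ n / R ^ n) ^ a * (R ^ (α * p * a) / (α * p * a)) *
      ((8 * R) ^ ((n : ℝ) - α * p)) ^ a =
      (2 * 6 ^ n * 8 ^ ((n : ℝ) - α * p)) ^ a / (α * p * a) := by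
    have h1 : (2 * 6 ^ n / R ^ n) ^ a * R ^ (α * p * a) * ((8 * R) ^ ((n : ℝ) - α * p)) ^ a =
        (2 * 6 ^ n * 8 ^ ((n : ℝ) - α * p)) ^ a := by
      rw [Real.rpow_mul hR.le, ← Real.mul_rpow (by positivity) (by positivity),
        ← Real.mul_rpow (by positivity) (by positivity), Real.mul_rpow (by norm_num) hR.le,
        Real.rpow_sub hR, Real.rpow_natCast]
      congr 1
      field_simp
    rw [← h1]; ring
  rw [wolffPotential, wolffTail, ← Ioc_union_Ioi_eq_Ioi hR.le, lintegral_union measurableSet_Ioi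
    (Ioc_disjoint_Ioi le_rfl), decayConst, add_mul]
  refine add_le_add (hnear.trans ?_) hfar
  refine (mul_le_mul_right hNZ _).trans (le_of_eq ?_)
  rw [← ha_def, ← hconst, ENNReal.ofReal_mul (q := ((8 * R) ^ ((n : ℝ) - α * p)) ^ a)
    (by positivity)]
  ring

theorem tendsto_wolffTail_atTop {m : ℝ → ℝ≥0∞} (h : wolffTail n α p m 1 ≠ ∞) :
    Tendsto (fun k : ℕ => wolffTail n α p m k) atTop (nhds 0) := by
  set ρ := (volume : Measure ℝ).withDensity fun r =>
    (m r / ENNReal.ofReal (r ^ ((n : ℝ) - α * p))) ^ (1 / (p - 1)) / ENNReal.ofReal r with hρ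
  have hT : ∀ t, wolffTail n α p m t = ρ (Ioi t) := fun t =>
    (withDensity_apply _ measurableSet_Ioi).symm
  simp only [hT]
  have hempty : ⋂ k : ℕ, Ioi (k : ℝ) = ∅ := by
    ext x
    simp only [mem_iInter, mem_Ioi, mem_empty_iff_false, iff_false, not_forall, not_lt]
    exact exists_nat_ge x
  have := tendsto_measure_iInter_atTop (μ := ρ) (s := fun k : ℕ => Ioi (k : ℝ))
    (fun k => measurableSet_Ioi.nullMeasurableSet)
    (fun i j h => Ioi_subset_Ioi (by exact_mod_cast h)) ⟨1, by
      rw [← hT]; simpa using h⟩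
  simpa [hempty, Function.comp_def] using this

theorem liminf_wolffPotential_eq_zero (hn : 0 < n) (hp : 1 < p) (hα : 0 < α)
    (hγ : α * p ≤ n) {ω : Measure (EuclideanSpace ℝ (Fin n))}
    (hω : ∀ r : ℝ, ω (Metric.ball 0 r) ≠ ∞)
    (h : wolffTail n α p (fun r => ω (Metric.ball 0 r)) 1 ≠ ∞) :
    liminf (wolffPotential n α p ω) (Bornology.cobounded (EuclideanSpace ℝ (Fin n))) = 0 := by
  refine le_antisymm (le_of_forall_gt fun ε hε => ?_) bot_le
  obtain ⟨ε', hε'0, hε'⟩ := exists_between hε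
  refine lt_of_le_of_lt ?_ hε'
  refine liminf_le_of_frequently_le' ?_
  have ht : Tendsto (fun k : ℕ => decayConst n α p *
      wolffTail n α p (fun r => ω (Metric.ball 0 r)) k) atTop (nhds 0) := by
    simpa using ENNReal.Tendsto.const_mul (tendsto_wolffTail_atTop h)
      (Or.inr (decayConst_ne_top hp))
  rw [(hasBasis_cobounded_norm (E := EuclideanSpace ℝ (Fin n))).frequently_iff]
  intro R _
  obtain ⟨k, hk, hRk⟩ := ((ht.eventually (ge_mem_nhds hε'0)).and
    (eventually_ge_atTop (max 1 ⌈R⌉₊))).exists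
  have hk1 : (1 : ℝ) ≤ k := by exact_mod_cast (le_max_left _ _).trans hRk
  have hRk' : R ≤ k := (Nat.le_ceil R).trans (by exact_mod_cast (le_max_right _ _).trans hRk)
  obtain ⟨x, hx, hWx⟩ := exists_wolffPotential_le_wolffTail hn hp hα hγ ω
    (R := k) (by linarith) (hω _)
  refine ⟨x, hRk'.trans hx, hWx.trans (le_trans ?_ hk)⟩
  gcongr
  exact wolffTail_anti (by linarith)

end Infinity

/-! ### Finiteness of the solution and assembly of the constants. -/

section Main

variable {n : ℕ} {α p q : ℝ} {σ : Measure (EuclideanSpace ℝ (Fin n))}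

theorem ne_top_of_wolffTail_ne_top (hp : 1 < p) (hγ : α * p ≤ n) {m : ℝ → ℝ≥0∞} (hm : Monotone m)
    {t : ℝ} (ht : 0 < t) (h : wolffTail n α p m t ≠ ∞) : m t ≠ ∞ := by
  intro hmt
  have := le_wolffTail (n := n) hp hγ hm ht
  rw [hmt, ENNReal.top_div_of_ne_top (by simp),
    ENNReal.top_rpow_of_pos (one_div_sub_one_pos hp), ENNReal.top_div_of_ne_top (by simp)] at this
  exact h (top_le_iff.1 this)

/-- The constant in the lower bound of supersolutions. -/
noncomputable def supersolutionConst (n : ℕ) (α p q : ℝ) : ℝ≥0∞ :=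
  (energyConst n α p q ^ ((p - 1) / (p - 1 - q))) ^ (1 / (p - 1)) +
    lowerConst n α p q ^ ((p - 1) / (p - 1 - q))

theorem supersolutionConst_ne_top (hp : 1 < p) (hq : 0 < q) (hqp : q < p - 1) :
    supersolutionConst n α p q ≠ ∞ := by
  have hp1 : 0 < p - 1 := sub_pos.2 hp
  have hd : 0 < p - 1 - q := by linarith
  have hδ : 0 ≤ (p - 1) / (p - 1 - q) := by positivity
  exact ENNReal.add_ne_top.2 ⟨ENNReal.rpow_ne_top_of_nonneg (one_div_sub_one_pos hp).le
    (ENNReal.rpow_ne_top_of_nonneg hδ (energyConst_ne_top hq hqp)),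
    ENNReal.rpow_ne_top_of_nonneg hδ (lowerConst_ne_top hp hq hqp)⟩

theorem wolffBound_le_wolffOp [SFinite σ] (hp : 1 < p) (hγ : α * p ≤ n) (hq : 0 < q)
    (hqp : q < p - 1) {u : EuclideanSpace ℝ (Fin n) → ℝ≥0∞}
    (hu : IsNontrivialWolffSupersolution n α p q σ u) (x) :
    wolffBound n α p q σ x ≤ supersolutionConst n α p q * wolffOp n α p q σ u x := by
  rw [supersolutionConst, add_mul]
  exact add_le_add (intrinsicPotential_le_wolffOp hp hγ hq hqp hu x)
    (wolffPotential_rpow_le_wolffOp hp hγ hq hqp hu x)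

theorem IsWolffSolution.isNontrivialWolffSupersolution (hσ : σ ≠ 0)
    {u : EuclideanSpace ℝ (Fin n) → ℝ≥0∞} (hu : IsWolffSolution n α p q σ u) :
    IsNontrivialWolffSupersolution n α p q σ u := by
  refine ⟨hu.memLqLoc, Eventually.of_forall fun x => (hu.eq x).ge, fun h => hσ ?_⟩
  rw [← ae_eq_bot, ← Filter.eventually_false_iff_eq_bot]
  filter_upwards [h] with x hx
  exact (hu.pos x).ne' hx

theorem withDensity_wolffSol_ball_le [IsLocallyFiniteMeasure σ] (hp : 1 < p) (hγ : α * p ≤ n)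
    (hq : 0 < q) (hqp : q < p - 1) (x : EuclideanSpace ℝ (Fin n)) (r : ℝ) :
    σ.withDensity (fun y => wolffSol n α p q σ y ^ q) (Metric.ball x r) ≤
      (upperConst n α p q ^ ((p - 1) / (p - 1 - q))) ^ q *
        σ.withDensity (fun y => wolffBound n α p q σ y ^ q) (Metric.ball x r) := by
  have hp1 : 0 < p - 1 := sub_pos.2 hp
  have hd : 0 < p - 1 - q := by linarith
  rw [withDensity_apply _ Metric.isOpen_ball.measurableSet,
    withDensity_apply _ Metric.isOpen_ball.measurableSet, ← lintegral_const_mul' _ _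
      (ENNReal.rpow_ne_top_of_nonneg hq.le (ENNReal.rpow_ne_top_of_nonneg (by positivity)
        (upperConst_ne_top hp hq hqp)))]
  refine lintegral_mono fun y => ?_
  rw [← ENNReal.mul_rpow_of_nonneg _ _ hq.le]
  exact ENNReal.rpow_le_rpow (wolffSol_le_wolffBound hp hγ hq hqp y) hq.le

theorem isWolffSolution_wolffSol [IsLocallyFiniteMeasure σ] (hn : 0 < n) (hp : 1 < p)
    (hα : 0 < α) (hγ : α * p ≤ n) (hq : 0 < q) (hqp : q < p - 1) (hσ : σ ≠ 0)
    (hW : wolffTail n α p (fun r => σ (Metric.ball 0 r)) 1 ≠ ∞)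
    (hK : wolffTail n α p (kappaPow n α p q σ 0) 1 ≠ ∞) :
    IsWolffSolution n α p q σ (wolffSol n α p q σ) ∧
      liminf (wolffSol n α p q σ) (Bornology.cobounded (EuclideanSpace ℝ (Fin n))) = 0 := by
  have hp1 : 0 < p - 1 := sub_pos.2 hp
  have hd : 0 < p - 1 - q := by linarith
  set C := (upperConst n α p q ^ ((p - 1) / (p - 1 - q))) ^ q with hC
  have hCt : C ≠ ∞ := ENNReal.rpow_ne_top_of_nonneg hq.le
    (ENNReal.rpow_ne_top_of_nonneg (by positivity) (upperConst_ne_top hp hq hqp))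
  have hT : tailBound n α p q σ 0 1 ≠ ∞ :=
    ENNReal.add_ne_top.2 ⟨hK, ENNReal.rpow_ne_top_of_nonneg (by positivity) hW⟩
  set ω := σ.withDensity fun y => wolffSol n α p q σ y ^ q with hω
  have hball : ∀ r : ℝ, ω (Metric.ball 0 r) ≠ ∞ := by
    intro r
    -- Keeps t above the tail level T = 1; finiteness of κ on B(0,2t) follows from the tail
    -- condition and monotonicity.
    set t := max r 2 with ht
    have ht2 : 2 ≤ t := le_max_right _ _
    have hκ : kappaPow n α p q σ 0 (2 * t) ≠ ∞ :=
      ne_top_of_wolffTail_ne_top hp hγ (monotone_kappaPow hp hq hqp 0) (by linarith)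
        ((wolffTail_anti (by linarith)).trans_lt hK.lt_top).ne
    have h1 := lintegral_ball_wolffBound_rpow_le (σ := σ) hp hγ hq hqp 0 (T := 1) (t := t)
      zero_le_one (by linarith)
    refine (((monotone_measure_ball ω 0 (le_max_left r 2)).trans
      (withDensity_wolffSol_ball_le hp hγ hq hqp 0 t)).trans_lt
      (ENNReal.mul_lt_top hCt.lt_top ?_)).ne
    rw [withDensity_apply _ Metric.isOpen_ball.measurableSet]
    refine h1.trans_lt (ENNReal.mul_lt_top (ENNReal.mul_lt_top
      (ENNReal.rpow_lt_top_of_nonneg hq.le (localConst_ne_top hp hq hqp))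
      (ENNReal.rpow_lt_top_of_nonneg hq.le (by simp))) (ENNReal.add_lt_top.2
      ⟨ENNReal.mul_lt_top (ENNReal.rpow_lt_top_of_nonneg hq.le hT) measure_ball_lt_top,
        hκ.lt_top⟩))
  have htail : wolffTail n α p (fun r => ω (Metric.ball 0 r)) 1 ≠ ∞ := by
    refine ((wolffTail_mono hp fun r _ =>
      withDensity_wolffSol_ball_le hp hγ hq hqp 0 r).trans_lt ?_).ne
    rw [wolffTail_const_mul hp hCt]
    exact ENNReal.mul_lt_top (ENNReal.rpow_lt_top_of_nonneg (by positivity) hCt)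
      ((wolffTail_wolffBound_le hp hγ hq hqp 0 zero_le_one).trans_lt
        (ENNReal.mul_lt_top (upperConst_ne_top hp hq hqp).lt_top hT.lt_top))
  have heq : wolffSol n α p q σ = wolffPotential n α p ω :=
    funext fun x => wolffSol_eq hp hγ hq hqp x
  refine ⟨⟨⟨measurable_wolffSol.aemeasurable, fun x r => ?_⟩, wolffSol_pos hp hγ hq hqp hσ,
    wolffSol_eq hp hγ hq hqp⟩, ?_⟩
  · rw [← withDensity_apply _ Metric.isOpen_ball.measurableSet]
    refine (measure_mono (Metric.ball_subset_ball' (le_refl _))).trans_lt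
      (hball (r + dist x 0)).lt_top
  · rw [heq]
    exact liminf_wolffPotential_eq_zero hn hp hα hγ hball htail

end Main

theorem theorem4p8 (n : ℕ) (α p q : ℝ) (hp : 1 < p) (hq : 0 < q) (hqp : q < p - 1)
    (hα : 0 < α) (hαn : α < n / p) :
    ∃ C : ℝ, 0 < C ∧
      ∀ σ : Measure (EuclideanSpace ℝ (Fin n)), IsLocallyFiniteMeasure σ → σ ≠ 0 →
        (wolffTail n α p (fun r => σ (Metric.ball 0 r)) 1 < ∞ →
          wolffTail n α p (kappaPow n α p q σ 0) 1 < ∞ →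
          ∃ u : EuclideanSpace ℝ (Fin n) → ℝ≥0∞,
            IsWolffSolution n α p q σ u ∧
            liminf u (Bornology.cobounded (EuclideanSpace ℝ (Fin n))) = 0 ∧
            ∀ x, ENNReal.ofReal C⁻¹ * wolffBound n α p q σ x ≤ u x ∧
              u x ≤ ENNReal.ofReal C * wolffBound n α p q σ x) ∧
        ∀ u : EuclideanSpace ℝ (Fin n) → ℝ≥0∞, IsNontrivialWolffSupersolution n α p q σ u →
          (∀ᵐ x ∂σ, ENNReal.ofReal C⁻¹ * wolffBound n α p q σ x ≤ u x) ∧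
          ∀ x, wolffOp n α p q σ u x ≤ u x →
            ENNReal.ofReal C⁻¹ * wolffBound n α p q σ x ≤ u x := by
  have hp0 : 0 < p := one_pos.trans hp
  have hp1 : 0 < p - 1 := sub_pos.2 hp
  have hd : 0 < p - 1 - q := by linarith
  have hγ : α * p ≤ n := ((lt_div_iff₀ hp0).1 hαn).le
  have hn : 0 < n := by
    have : (0 : ℝ) < n := (mul_pos hα hp0).trans_le hγ
    exact_mod_cast this
  have hU1 : 1 ≤ upperConst n α p q ^ ((p - 1) / (p - 1 - q)) :=
    ENNReal.one_le_rpow (one_le_upperConst hp hγ hq) (by positivity)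
  have hUt : upperConst n α p q ^ ((p - 1) / (p - 1 - q)) ≠ ∞ :=
    ENNReal.rpow_ne_top_of_nonneg (by positivity) (upperConst_ne_top hp hq hqp)
  set C := supersolutionConst n α p q + upperConst n α p q ^ ((p - 1) / (p - 1 - q)) with hC
  have hCt : C ≠ ∞ := ENNReal.add_ne_top.2 ⟨supersolutionConst_ne_top hp hq hqp, hUt⟩
  have hC1 : 1 ≤ C := hU1.trans le_add_self
  have hC0 : C ≠ 0 := (zero_lt_one.trans_le hC1).ne'
  have hCr : 0 < C.toReal := ENNReal.toReal_pos hC0 hCt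
  have hCinv : ENNReal.ofReal C.toReal⁻¹ = C⁻¹ := by
    rw [ENNReal.ofReal_inv_of_pos hCr, ENNReal.ofReal_toReal hCt]
  refine ⟨C.toReal, hCr, fun σ _ hσ => ?_⟩
  rw [hCinv, ENNReal.ofReal_toReal hCt]
  have hlow : ∀ u : EuclideanSpace ℝ (Fin n) → ℝ≥0∞, IsNontrivialWolffSupersolution n α p q σ u →
      ∀ x, wolffOp n α p q σ u x ≤ u x → C⁻¹ * wolffBound n α p q σ x ≤ u x := by
    intro u hu x hx
    rw [mul_comm, ← div_eq_mul_inv]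
    refine ENNReal.div_le_of_le_mul' ((wolffBound_le_wolffOp hp hγ hq hqp hu x).trans ?_)
    gcongr
    exact le_self_add
  refine ⟨fun hW hK => ?_, fun u hu => ⟨?_, hlow u hu⟩⟩
  · obtain ⟨hsol, hlim⟩ := isWolffSolution_wolffSol hn hp hα hγ hq hqp hσ hW.ne hK.ne
    refine ⟨wolffSol n α p q σ, hsol, hlim, fun x => ⟨?_, ?_⟩⟩
    · exact hlow _ (hsol.isNontrivialWolffSupersolution hσ) x (hsol.eq x).ge
    · refine (wolffSol_le_wolffBound hp hγ hq hqp x).trans ?_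
      gcongr
      exact le_add_self
  · filter_upwards [hu.le] with x hx
    exact hlow u hu x hx
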